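/- Let $\mathcal X,\mathcal Y$ be finite sets, and let $X=(X_0,X_1,\dots)$ and $Y=(Y_0,Y_1,\dots)$ be stationary Markov chains on $\mathcal X$ and $\mathcal Y$ with transition matrices $P,Q$ and stationary distributions $p,q$, where every state is visited with positive probability, i.e. $p(x)>0$ and $q(y)>0$ for all $x\in\mathcal X$, $y\in\mathcal Y$ (this is automatic if $X$ and $Y$ are irreducible). Let $c:\mathcal X\times\mathcal Y\to\mathbb R$ be a cost function. For distributions $\mu$ on $\mathcal X$ and $\nu$ on $\mathcal Y$ let $\Pi(\mu,\nu)$ be the polytope of their couplings, and let $\Pi_{TC}(P,Q)$ be the set of transition couplings, i.e. of matrices $R$ indexed by $\mathcal S=\mathcal X\times\mathcal Y$ with $R((x,y),\cdot)\in\Pi(P(x,\cdot),Q(y,\cdot))$ for all $(x,y)\in\mathcal S$. A transition coupling of $X$ and $Y$ with transition matrix $R\in\Pi_{TC}(P,Q)$ is a stationary Markov chain $(\tilde X,\tilde Y)$ on $\mathcal S$ with transition matrix $R$ such that $\tilde X$ and $\tilde Y$ have the laws of $X$ and $Y$; it is optimal if it minimizes $\mathbb E\,c(\tilde X_0,\tilde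 Y_0)$ among all transition couplings of $X$ and $Y$ (with any transition matrix). TC-MDP is the average-cost Markov decision process with state space $\mathcal S$, admissible actions $\Pi(P(x,\cdot),Q(y,\cdot))$ in state $s=(x,y)$, cost $c(s)$, and next state distributed as $r$ if the action $r$ is chosen. A policy $\gamma$ consists of a probability distribution $\gamma_s$ on the admissible actions for each state $s$; each $R\in\Pi_{TC}(P,Q)$ is a deterministic policy. Let $\bar c_\gamma(s)=\lim_{T\to\infty}\frac1T\sum_{t=1}^T\mathbb E_\gamma[c(s_t)\mid s_0=s]$. A solution of TC-MDP is a triple $(g,h,R)$ with $R\in\Pi_{TC}(P,Q)$ such that $g=\bar c_R$, such that $h=\sum_{t\ge0}R^t(c-g)$ (summed in the sense of Cesàro), such that for every policy $\gamma$ and state $s$ the limit $\bar c_\gamma(s)$ exists and $g(s)\le\bar c_\gamma(s)$, and such that, with element-wise minima over $R'\in\Pi_{TC}(P,Q)$, $$g=Rg=\min_{R'}R'g,\qquad g+h=c+Rh,\qquad Rh=\min_{R'}R'h .$$ The algorithm ExactOTC starts from $R_0=P\otimes Q$ (that is, $R_0((x,y),(x',y'))=P(x,x')Q(y,y')$) and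 for $n=0,1,2,\dots$ does the following. * Evaluation: $(g_n,h_n)$ is obtained by solving, for $(g_n,h_n,w)$, the linear system $(I-R_n)g_n=0$, $g_n+(I-R_n)h_n=c$, $h_n+(I-R_n)w=0$. * Improvement: let $R'$ be an element-wise minimizer of $R\mapsto Rg_n$ over $\Pi_{TC}(P,Q)$. If $R'g_n\ne R_ng_n$, put $R_{n+1}=R'$. Otherwise let $R''$ be an element-wise minimizer of $R\mapsto Rh_n$ over $\Pi_{TC}(P,Q)$; if $R''h_n\neq R_nh_n$ put $R_{n+1}=R''$, and otherwise put $R_{n+1}=R_n$. Here an element-wise minimizer of $R\mapsto Rf$ ($f=g_n$ or $f=h_n$) is computed by solving, for each $(x,y)\in\mathcal S$, the optimal transport linear program of minimizing $\sum_{s'} r(s')f(s')$ over $r\in\Pi(P(x,\cdot),Q(y,\cdot))$; the solution returned is a vertex of $\Pi(P(x,\cdot),Q(y,\cdot))$, and it is the current row $R_n((x,y),\cdot)$ whenever that row is itself an optimal vertex. Ties are otherwise broken arbitrarily. **Theorem.** ExactOTC can be carried out, and however the remaining ties are broken, it converges in finitely many iterations to a solution of TC-MDP: there are a solution $(g^*,h^*,R^*)$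 of TC-MDP and $N\in\mathbb N$ such that $(g_n,h_n,R_n)=(g^*,h^*,R^*)$ for all $n\ge N$. Moreover, if $X$ and $Y$ are irreducible, then $R^*$ is the transition matrix of an optimal transition coupling of $X$ and $Y$. -/

import Mathlib

open Matrix MeasureTheory Filter Topology
open scoped Kronecker

noncomputable section

namespace OTC

/-! ### Stationary Markov chains and (transition) couplings -/

/-- `μ` is the law on sequence space of a stationary Markov chain with stationary
distribution `p` and transition matrix `P`. -/
structure IsStationaryMarkovLaw {S : Type*} [Fintype S] [DecidableEq S] [MeasurableSpace S]
    (μ : Measure (ℕ → S)) (p : S → ℝ) (P : Matrix S S ℝ) : Prop where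
  isProbabilityMeasure : IsProbabilityMeasure μ
  stochastic : P ∈ Matrix.rowStochastic ℝ S
  distribution : p ∈ stdSimplex ℝ S
  stationary : p ᵥ* P = p
  cylinder : ∀ (i j : ℕ), i ≤ j → ∀ a : ℕ → S,
    μ {ω | ∀ k ∈ Finset.Icc i j, ω k = a k} =
      ENNReal.ofReal (p (a i) * ∏ k ∈ Finset.Ico i j, P (a k) (a (k + 1)))

/-- The set `Π(μ, ν)` of couplings of two distributions on finite sets. -/
def couplings {X Y : Type*} [Fintype X] [Fintype Y] (μ : X → ℝ) (ν : Y → ℝ) :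
    Set (X × Y → ℝ) :=
  {r | (∀ s, 0 ≤ r s) ∧ (∀ x, ∑ y, r (x, y) = μ x) ∧ (∀ y, ∑ x, r (x, y) = ν y)}

/-- The set `Π_TC(P, Q)` of transition coupling matrices. -/
def transitionCouplings {X Y : Type*} [Fintype X] [Fintype Y]
    (P : Matrix X X ℝ) (Q : Matrix Y Y ℝ) : Set (Matrix (X × Y) (X × Y) ℝ) :=
  {R | ∀ s : X × Y, R s ∈ couplings (P s.1) (Q s.2)}

/-- `π` is (the law of) a transition coupling, with transition matrix `R`, of the stationary
Markov chains with laws `μ`, `ν` and transition matrices `P`, `Q`. -/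
structure IsTransitionCoupling {X Y : Type*} [Fintype X] [DecidableEq X] [MeasurableSpace X]
    [Fintype Y] [DecidableEq Y] [MeasurableSpace Y]
    (P : Matrix X X ℝ) (Q : Matrix Y Y ℝ) (μ : Measure (ℕ → X)) (ν : Measure (ℕ → Y))
    (R : Matrix (X × Y) (X × Y) ℝ) (π : Measure ((ℕ → X) × (ℕ → Y))) : Prop where
  mem : R ∈ transitionCouplings P Q
  fst : π.map Prod.fst = μ
  snd : π.map Prod.snd = ν
  markov : ∃ r : X × Y → ℝ,
    IsStationaryMarkovLaw (π.map fun ω : (ℕ → X) × (ℕ → Y) => fun i => (ω.1 i, ω.2 i)) r R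

/-- `R` is the transition matrix of an optimal transition coupling for the single-letter
cost `c`. -/
def IsOptimalTransitionMatrix {X Y : Type*} [Fintype X] [DecidableEq X] [MeasurableSpace X]
    [Fintype Y] [DecidableEq Y] [MeasurableSpace Y]
    (P : Matrix X X ℝ) (Q : Matrix Y Y ℝ) (μ : Measure (ℕ → X)) (ν : Measure (ℕ → Y))
    (c : X × Y → ℝ) (R : Matrix (X × Y) (X × Y) ℝ) : Prop :=
  ∃ π, IsTransitionCoupling P Q μ ν R π ∧
    ∀ R' π', IsTransitionCoupling P Q μ ν R' π' →
      ∫ ω, c (ω.1 0, ω.2 0) ∂π ≤ ∫ ω, c (ω.1 0, ω.2 0) ∂π'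

/-! ### The Markov decision process -/

/-- A (randomized) policy: for each state `s = (x, y)`, a probability distribution on the set
`Π(P(x,·), Q(y,·))` of admissible actions. -/
structure IsPolicy {X Y : Type*} [Fintype X] [Fintype Y]
    (P : Matrix X X ℝ) (Q : Matrix Y Y ℝ) (γ : X × Y → Measure (X × Y → ℝ)) : Prop where
  isProbabilityMeasure : ∀ s, IsProbabilityMeasure (γ s)
  admissible : ∀ s : X × Y, ∀ᵐ r ∂(γ s), r ∈ couplings (P s.1) (Q s.2)

/-- The deterministic policy that always chooses the action `R(s,·)` in state `s`. -/
def detPolicy {S : Type*} (R : Matrix S S ℝ) : S → Measure (S → ℝ) :=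
  fun s => Measure.dirac (R s)

/-- The expected cost `E_γ[c(s_t) | s_0 = s]`: in state `s` an action `r` is drawn from `γ s`,
and the next state is drawn from `r`. -/
def expectedCost {S : Type*} [Fintype S] (γ : S → Measure (S → ℝ)) (c : S → ℝ) :
    ℕ → S → ℝ
  | 0, s => c s
  | t + 1, s => ∫ r, ∑ s', r s' * expectedCost γ c t s' ∂(γ s)

/-- The limiting average cost of the policy `γ` from the initial state `s` exists and is `L`. -/
def HasAverageCost {S : Type*} [Fintype S] (γ : S → Measure (S → ℝ)) (c : S → ℝ)
    (s : S) (L : ℝ) : Prop :=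
  Tendsto (fun T : ℕ => (1 / (T : ℝ)) * ∑ t ∈ Finset.Icc 1 T, expectedCost γ c t s)
    atTop (𝓝 L)

/-- `h` is the bias `∑ₜ Rᵗ (c - g)`, the series being summed in the sense of Cesàro, as is
necessary for periodic `R`. -/
def IsBias {S : Type*} [Fintype S] [DecidableEq S] (R : Matrix S S ℝ) (c g h : S → ℝ) : Prop :=
  ∀ s, Tendsto (fun T : ℕ => (1 / (T : ℝ)) *
      ∑ n ∈ Finset.range T, ∑ t ∈ Finset.range n, ((R ^ t) *ᵥ (c - g)) s)
    atTop (𝓝 (h s))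

/-- `(g, h, R)` solves the average-cost Markov decision process: `R` is a deterministic policy,
`g` and `h` are its average cost and bias, `R` is optimal from every initial state among all
policies, and `(g, h)` satisfies the optimality equations `g = min_R R g` and
`g + h = c + min_R R h`, both minima being attained at the given `R`. -/
structure IsSolution {X Y : Type*} [Fintype X] [DecidableEq X] [Fintype Y] [DecidableEq Y]
    (P : Matrix X X ℝ) (Q : Matrix Y Y ℝ) (c g h : X × Y → ℝ)
    (R : Matrix (X × Y) (X × Y) ℝ) : Prop where
  mem : R ∈ transitionCouplings P Q
  gain : ∀ s, HasAverageCost (detPolicy R) c s (g s)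
  bias : IsBias R c g h
  optimal : ∀ γ, IsPolicy P Q γ → ∀ s, ∃ L, HasAverageCost γ c s L ∧ g s ≤ L
  gain_eq : R *ᵥ g = g
  gain_min : ∀ R' ∈ transitionCouplings P Q, ∀ s, (R *ᵥ g) s ≤ (R' *ᵥ g) s
  bias_eq : g + h = c + R *ᵥ h
  bias_min : ∀ R' ∈ transitionCouplings P Q, ∀ s, (R *ᵥ h) s ≤ (R' *ᵥ h) s

/-! ### The algorithm -/

/-- Transition coupling evaluation: `(g, h)` is the output on input `R`. -/
def ExactTCE {S : Type*} [Fintype S] [DecidableEq S] (c : S → ℝ) (R : Matrix S S ℝ)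
    (g h : S → ℝ) : Prop :=
  ∃ w : S → ℝ, (1 - R) *ᵥ g = 0 ∧ g + (1 - R) *ᵥ h = c ∧ h + (1 - R) *ᵥ w = 0

/-- The set of solutions of the optimal transport problem with marginals `μ`, `ν` and
cost `f`. -/
def otSolutions {X Y : Type*} [Fintype X] [Fintype Y] (μ : X → ℝ) (ν : Y → ℝ)
    (f : X × Y → ℝ) : Set (X × Y → ℝ) :=
  {r | r ∈ couplings μ ν ∧ ∀ r' ∈ couplings μ ν, r ⬝ᵥ f ≤ r' ⬝ᵥ f}

/-- `R'` is an element-wise argmin of `R ↦ R f` over the transition couplings, obtained by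
solving one optimal transport linear program for each state. As usual for linear programs and
for policy iteration, every solution is a vertex of the feasible polytope, and the row of the
current matrix `R₀` is returned if it is an optimal vertex. -/
def IsElemArgmin {X Y : Type*} [Fintype X] [Fintype Y]
    (P : Matrix X X ℝ) (Q : Matrix Y Y ℝ) (f : X × Y → ℝ)
    (R₀ R' : Matrix (X × Y) (X × Y) ℝ) : Prop :=
  ∀ s : X × Y,
    R' s ∈ otSolutions (P s.1) (Q s.2) f ∧
    R' s ∈ Set.extremePoints ℝ (couplings (P s.1) (Q s.2)) ∧
    (R₀ s ∈ otSolutions (P s.1) (Q s.2) f →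
      R₀ s ∈ Set.extremePoints ℝ (couplings (P s.1) (Q s.2)) → R' s = R₀ s)

/-- Transition coupling improvement: `R₁` is the output on input `(g, h, R₀)`. -/
def ExactTCI {X Y : Type*} [Fintype X] [Fintype Y]
    (P : Matrix X X ℝ) (Q : Matrix Y Y ℝ) (g h : X × Y → ℝ)
    (R₀ R₁ : Matrix (X × Y) (X × Y) ℝ) : Prop :=
  ∃ R', IsElemArgmin P Q g R₀ R' ∧
    ((R' *ᵥ g ≠ R₀ *ᵥ g ∧ R₁ = R') ∨
      (R' *ᵥ g = R₀ *ᵥ g ∧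
        ∃ R'', IsElemArgmin P Q h R₀ R'' ∧
          ((R'' *ᵥ h = R₀ *ᵥ h ∧ R₁ = R₀) ∨ (R'' *ᵥ h ≠ R₀ *ᵥ h ∧ R₁ = R''))))

/-- `(g n, h n, R n)`, `n = 0, 1, …`, are the iterates of a run of the algorithm started at the
independent transition coupling `P ⊗ Q`; after termination the run is continued. -/
structure IsExactOTCRun {X Y : Type*} [Fintype X] [DecidableEq X] [Fintype Y] [DecidableEq Y]
    (P : Matrix X X ℝ) (Q : Matrix Y Y ℝ) (c : X × Y → ℝ)
    (g h : ℕ → X × Y → ℝ) (R : ℕ → Matrix (X × Y) (X × Y) ℝ) : Prop where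
  init : R 0 = P ⊗ₖ Q
  evaluation : ∀ n, ExactTCE c (R n) (g n) (h n)
  improvement : ∀ n, ExactTCI P Q (g n) (h n) (R n) (R (n + 1))

end OTC

end

namespace OTC

/-! ### Cesàro averages of a stochastic matrix; gain and bias. -/

section Ergodic

/-! This is policy iteration for a multichain Markov decision process with infinite action sets.
Only the finitely many vertices of the coupling polytopes matter (`finite_extremePoints_couplings`),
so it suffices that no vertex matrix recurs while the run keeps changing. The potential is the pair
(gain, bias) in lexicographic order: `ExactTCI.lex_lt` shows that it drops strictly at every
nontrivial iteration from a matrix with vertex rows. The initial matrix `P ⊗ₖ Q` need not have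
vertex rows, but any matrix produced by a change does. Once a matrix is returned unchanged, it
minimizes both functions and the run stays there.

The drop is proved with the Cesàro limit `M'` of the powers of the new matrix. Applying `M'` to the
one-step improvement shows where it vanishes: on all recurrent states for a gain step, and likewise
for a bias step that leaves the gain unchanged. The tie-breaking rule then keeps the old rows there,
so gain and bias agree on the recurrent class, and sub- or superharmonicity extends the comparison
to the transient states.

In general a bias step must be restricted to actions that preserve the gain. Here this is automatic.
If `g` cannot be decreased, it is subharmonic for `P ⊗ₖ Q`, whose stationary distribution `p ⊗ q` is
positive, so it is constant along the transitions of `P ⊗ₖ Q`. These include the transitions of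
every transition coupling (`mulVec_eq_of_le_transitionCouplings`).

Optimality among randomized policies follows by averaging the actions (`IsPolicy.expectedCost_eq`).
For irreducible marginals, every stationary distribution of a transition coupling matrix gives a
coupling with the right marginal laws. A row of the ergodic limit at a state of least gain is such a
distribution, and its cost is that least gain, a lower bound for all competitors. -/

theorem mulVec_mono_of_nonneg {S : Type*} [Fintype S] {R : Matrix S S ℝ}
    (hR : ∀ i j, 0 ≤ R i j) {f g : S → ℝ} (hfg : f ≤ g) :
    R *ᵥ f ≤ R *ᵥ g := fun i =>
  Finset.sum_le_sum fun j _ => mul_le_mul_of_nonneg_left (hfg j) (hR i j)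

variable {S : Type*} [Fintype S] [DecidableEq S] {R M : Matrix S S ℝ}

theorem abs_mulVec_le_of_mem_rowStochastic (hR : R ∈ rowStochastic ℝ S) {f : S → ℝ} {B : ℝ}
    (hf : ∀ i, |f i| ≤ B) (i : S) : |(R *ᵥ f) i| ≤ B := by
  calc |(R *ᵥ f) i| ≤ ∑ j, |R i j * f j| := Finset.abs_sum_le_sum_abs _ _
    _ ≤ ∑ j, R i j * B := by
        refine Finset.sum_le_sum fun j _ => ?_
        rw [abs_mul, abs_of_nonneg (hR.1 i j)]
        exact mul_le_mul_of_nonneg_left (hf j) (hR.1 i j)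
    _ = B := by rw [← Finset.sum_mul, sum_row_of_mem_rowStochastic hR, one_mul]

theorem exists_forall_abs_pow_mulVec_le (hR : R ∈ rowStochastic ℝ S) (f : S → ℝ) :
    ∃ B, ∀ (n : ℕ) (i : S), |((R ^ n) *ᵥ f) i| ≤ B := by
  refine ⟨∑ j, |f j|, fun n i => ?_⟩
  exact abs_mulVec_le_of_mem_rowStochastic (pow_mem hR n)
    (fun i => Finset.single_le_sum (f := fun j => |f j|) (fun j _ => abs_nonneg _)
      (Finset.mem_univ i)) i

theorem pow_mulVec_of_fixed {k : S → ℝ} (hk : R *ᵥ k = k) (n : ℕ) : (R ^ n) *ᵥ k = k := by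
  induction n with
  | zero => simp
  | succ n ih => rw [pow_succ, ← mulVec_mulVec, hk, ih]

/-- Telescoping: the term at time `t` is `k + R ^ t w - R ^ (t + 1) w`. -/
theorem sum_pow_mulVec {f k w : S → ℝ} (hk : R *ᵥ k = k) (hf : f = k + (1 - R) *ᵥ w)
    (T : ℕ) (s : S) :
    ∑ t ∈ Finset.range T, ((R ^ t) *ᵥ f) s = T * k s + w s - ((R ^ T) *ᵥ w) s := by
  induction T with
  | zero => simp
  | succ T ih =>
    rw [Finset.sum_range_succ, ih, hf, mulVec_add, pow_mulVec_of_fixed hk, sub_mulVec, one_mulVec,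
      mulVec_sub, mulVec_mulVec, ← pow_succ]
    simp only [Pi.add_apply, Pi.sub_apply]
    push_cast
    ring

theorem tendsto_one_div_mul_of_bounded {a : ℕ → ℝ} {B : ℝ} (h : ∀ n, |a n| ≤ B) :
    Tendsto (fun T : ℕ => (1 / (T : ℝ)) * a T) atTop (𝓝 0) := by
  refine squeeze_zero_norm (a := fun T : ℕ => (1 / (T : ℝ)) * B) (fun T => ?_) ?_
  · rw [Real.norm_eq_abs, abs_mul, abs_of_nonneg (by positivity : (0 : ℝ) ≤ 1 / (T : ℝ))]
    exact mul_le_mul_of_nonneg_left (h T) (by positivity)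
  · simpa using tendsto_one_div_atTop_nhds_zero_nat.mul_const B

theorem tendsto_cesaro (hR : R ∈ rowStochastic ℝ S) {f k w : S → ℝ} (hk : R *ᵥ k = k)
    (hf : f = k + (1 - R) *ᵥ w) (s : S) :
    Tendsto (fun T : ℕ => (1 / (T : ℝ)) * ∑ t ∈ Finset.range T, ((R ^ t) *ᵥ f) s)
      atTop (𝓝 (k s)) := by
  obtain ⟨B, hB⟩ := exists_forall_abs_pow_mulVec_le hR w
  have h0 : Tendsto (fun T : ℕ => k s + (1 / (T : ℝ)) * (w s - ((R ^ T) *ᵥ w) s))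
      atTop (𝓝 (k s + 0)) := by
    refine tendsto_const_nhds.add (tendsto_one_div_mul_of_bounded (B := |w s| + B) fun n => ?_)
    exact (abs_sub _ _).trans (add_le_add le_rfl (hB n s))
  rw [add_zero] at h0
  refine h0.congr' ?_
  filter_upwards [eventually_gt_atTop 0] with T hT
  have : (T : ℝ) ≠ 0 := by positivity
  rw [sum_pow_mulVec hk hf]
  field_simp
  ring

/-- The space is the direct sum of kernel and range of `1 - R`. A vector in both has Cesàro means
converging to itself and to zero, so the two are disjoint; rank-nullity does the rest. -/
theorem exists_ergodic_decomposition (hR : R ∈ rowStochastic ℝ S) (f : S → ℝ) :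
    ∃ k w : S → ℝ, R *ᵥ k = k ∧ f = k + (1 - R) *ᵥ w := by
  set L := Matrix.toLin' (1 - R) with hL
  have hdisj : Disjoint (LinearMap.ker L) (LinearMap.range L) := by
    rw [Submodule.disjoint_def]
    rintro k hk ⟨w, rfl⟩
    set k := L w with hkw
    have hk' : R *ᵥ k = k := by
      rw [LinearMap.mem_ker, hL, toLin'_apply, sub_mulVec, one_mulVec, sub_eq_zero] at hk
      exact hk.symm
    funext s
    have h1 := tendsto_cesaro hR (f := k) (w := 0) hk' (by simp) s
    have h2 := tendsto_cesaro hR (f := k) (k := 0) (w := w) (by simp)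
      (by rw [hkw, hL, toLin'_apply, zero_add]) s
    exact tendsto_nhds_unique h1 h2
  have htop := Submodule.eq_top_of_disjoint (LinearMap.ker L) (LinearMap.range L)
    (by rw [add_comm, LinearMap.finrank_range_add_finrank_ker]) hdisj
  obtain ⟨k, hk, y, ⟨w, rfl⟩, rfl⟩ := Submodule.mem_sup.1 (htop ▸ Submodule.mem_top : f ∈ _)
  refine ⟨k, w, ?_, by rw [hL, toLin'_apply]⟩
  rw [LinearMap.mem_ker, hL, toLin'_apply, sub_mulVec, one_mulVec, sub_eq_zero] at hk
  exact hk.symm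

/-- `M` is the Cesàro limit of the powers of the stochastic matrix `R`. -/
structure IsErgodicLimit (R M : Matrix S S ℝ) : Prop where
  stochastic : R ∈ rowStochastic ℝ S
  mul_limit : R * M = M
  exists_potential : ∃ W, 1 = M + (1 - R) * W

theorem exists_isErgodicLimit (hR : R ∈ rowStochastic ℝ S) : ∃ M, IsErgodicLimit R M := by
  choose K W hK hW using fun j : S => exists_ergodic_decomposition hR (Pi.single j 1)
  refine ⟨of fun i j => K j i, hR, ?_, of fun i j => W j i, ?_⟩
  · ext i j
    exact congrFun (hK j) i
  · ext i j
    have := congrFun (hW j) i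
    rw [Matrix.one_apply, ← Pi.single_apply, this]
    rfl

namespace IsErgodicLimit

theorem exists_eq_add (hM : IsErgodicLimit R M) (f : S → ℝ) :
    ∃ w, f = M *ᵥ f + (1 - R) *ᵥ w := by
  obtain ⟨W, hW⟩ := hM.exists_potential
  refine ⟨W *ᵥ f, ?_⟩
  rw [mulVec_mulVec, ← add_mulVec, ← hW, one_mulVec]

theorem mulVec_fixed (hM : IsErgodicLimit R M) (f : S → ℝ) : R *ᵥ (M *ᵥ f) = M *ᵥ f := by
  rw [mulVec_mulVec, hM.mul_limit]

theorem tendsto (hM : IsErgodicLimit R M) (f : S → ℝ) (s : S) :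
    Tendsto (fun T : ℕ => (1 / (T : ℝ)) * ∑ t ∈ Finset.range T, ((R ^ t) *ᵥ f) s)
      atTop (𝓝 ((M *ᵥ f) s)) := by
  obtain ⟨w, hw⟩ := hM.exists_eq_add f
  exact tendsto_cesaro hM.stochastic (hM.mulVec_fixed f) hw s

/-- Any splitting into an invariant part and a coboundary computes the limit, so the invariant part
is unique. -/
theorem mulVec_eq (hM : IsErgodicLimit R M) {f k w : S → ℝ} (hk : R *ᵥ k = k)
    (hf : f = k + (1 - R) *ᵥ w) : M *ᵥ f = k :=
  funext fun s => tendsto_nhds_unique (hM.tendsto f s) (tendsto_cesaro hM.stochastic hk hf s)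

theorem mulVec_of_fixed (hM : IsErgodicLimit R M) {k : S → ℝ} (hk : R *ᵥ k = k) :
    M *ᵥ k = k :=
  hM.mulVec_eq (w := 0) hk (by simp)

theorem mulVec_one_sub (hM : IsErgodicLimit R M) (w : S → ℝ) : M *ᵥ ((1 - R) *ᵥ w) = 0 :=
  hM.mulVec_eq (w := w) (by simp) (by simp)

theorem mulVec_mulVec_right (hM : IsErgodicLimit R M) (f : S → ℝ) :
    M *ᵥ (R *ᵥ f) = M *ᵥ f := by
  have := hM.mulVec_one_sub f
  rwa [sub_mulVec, one_mulVec, mulVec_sub, sub_eq_zero, eq_comm] at this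

theorem limit_mul (hM : IsErgodicLimit R M) : M * R = M := by
  refine ext_of_mulVec_single fun j => ?_
  rw [← mulVec_mulVec, hM.mulVec_mulVec_right]

theorem limit_nonneg (hM : IsErgodicLimit R M) (i j : S) : 0 ≤ M i j := by
  have h := hM.tendsto (Pi.single j 1) i
  rw [mulVec_single_one, col_apply] at h
  refine ge_of_tendsto' h fun T => ?_
  refine mul_nonneg (by positivity) (Finset.sum_nonneg fun t _ => ?_)
  rw [mulVec_single_one, col_apply]
  exact nonneg_of_mem_rowStochastic (pow_mem hM.stochastic t)

theorem limit_mem (hM : IsErgodicLimit R M) : M ∈ rowStochastic ℝ S :=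
  ⟨hM.limit_nonneg, hM.mulVec_of_fixed hM.stochastic.2⟩

/-- A function that decreases along `R` dominates its limit. -/
theorem mulVec_le (hM : IsErgodicLimit R M) {f : S → ℝ} (hf : R *ᵥ f ≤ f) : M *ᵥ f ≤ f := by
  intro s
  have hpow : ∀ t : ℕ, (R ^ t) *ᵥ f ≤ f := by
    intro t
    induction t with
    | zero => simp
    | succ t ih =>
      rw [pow_succ', ← mulVec_mulVec]
      exact (mulVec_mono_of_nonneg hM.stochastic.1 ih).trans hf
  refine le_of_tendsto (hM.tendsto f s) ?_
  filter_upwards [eventually_gt_atTop 0] with T hT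
  have hT' : (0 : ℝ) < T := by positivity
  rw [one_div, inv_mul_le_iff₀ hT']
  calc _ ≤ ∑ t ∈ Finset.range T, f s := Finset.sum_le_sum fun t _ => hpow t s
    _ = _ := by simp

theorem le_mulVec (hM : IsErgodicLimit R M) {f : S → ℝ} (hf : f ≤ R *ᵥ f) : f ≤ M *ᵥ f := by
  have := hM.mulVec_le (f := -f) (by rw [mulVec_neg]; exact neg_le_neg hf)
  rw [mulVec_neg] at this
  exact neg_le_neg_iff.1 this

/-- The average cost, with the sum starting at time `1`. -/
theorem tendsto_Icc (hM : IsErgodicLimit R M) (f : S → ℝ) (s : S) :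
    Tendsto (fun T : ℕ => (1 / (T : ℝ)) * ∑ t ∈ Finset.Icc 1 T, ((R ^ t) *ᵥ f) s)
      atTop (𝓝 ((M *ᵥ f) s)) := by
  have h := hM.tendsto (R *ᵥ f) s
  rw [hM.mulVec_mulVec_right] at h
  refine h.congr fun T => ?_
  congr 1
  rw [← Finset.Ico_add_one_right_eq_Icc, Finset.sum_Ico_eq_sum_range]
  refine Finset.sum_congr (by simp) fun t _ => ?_
  rw [mulVec_mulVec, ← pow_succ, add_comm]

end IsErgodicLimit

variable {c g h g' h' : S → ℝ}

theorem exists_exactTCE (hR : R ∈ rowStochastic ℝ S) (c : S → ℝ) : ∃ g h, ExactTCE c R g h := by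
  obtain ⟨M, hM⟩ := exists_isErgodicLimit hR
  obtain ⟨w, hw⟩ := hM.exists_eq_add c
  obtain ⟨v, hv⟩ := hM.exists_eq_add w
  have h1 : ∀ f, (1 - R) *ᵥ (M *ᵥ f) = 0 := fun f => by
    rw [sub_mulVec, one_mulVec, hM.mulVec_fixed, sub_self]
  -- The third equation forces the bias into the range of `1 - R`. Hence `w` is replaced by its
  -- coboundary part; the discarded part `M w` is invisible to `1 - R`.
  refine ⟨M *ᵥ c, (1 - R) *ᵥ v, -v, h1 c, ?_, ?_⟩
  · conv_rhs => rw [hw, hv, mulVec_add, h1, zero_add]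
  · rw [mulVec_neg, add_neg_cancel]

namespace ExactTCE

theorem gain_fixed (H : ExactTCE c R g h) : R *ᵥ g = g := by
  obtain ⟨w, h1, -, -⟩ := H
  rw [sub_mulVec, one_mulVec, sub_eq_zero] at h1
  exact h1.symm

theorem cost_eq (H : ExactTCE c R g h) : g + h = c + R *ᵥ h := by
  obtain ⟨w, -, h2, -⟩ := H
  rw [← h2, sub_mulVec, one_mulVec]
  abel

theorem gain_eq (hM : IsErgodicLimit R M) (H : ExactTCE c R g h) : g = M *ᵥ c := by
  have h1 := H.gain_fixed
  obtain ⟨w, -, h2, -⟩ := H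
  exact (hM.mulVec_eq h1 h2.symm).symm

/-- The partial sums telescope to `h - R ^ n h`, and the third equation makes the Cesàro means of `R
^ n h` vanish. -/
theorem isBias (hR : R ∈ rowStochastic ℝ S) (H : ExactTCE c R g h) : IsBias R c g h := by
  obtain ⟨w, -, h2, h3⟩ := H
  intro s
  have hcg : c - g = 0 + (1 - R) *ᵥ h := by rw [← h2]; simp
  have hs : ∀ n : ℕ, ∑ t ∈ Finset.range n, ((R ^ t) *ᵥ (c - g)) s = h s - ((R ^ n) *ᵥ h) s := by
    intro n
    rw [sum_pow_mulVec (by simp) hcg]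
    simp
  have h4 := tendsto_cesaro hR (f := h) (k := 0) (w := -w) (by simp)
    (by rw [mulVec_neg, zero_add]; exact eq_neg_of_add_eq_zero_left h3) s
  have h5 := (tendsto_const_nhds (x := h s)).sub h4
  rw [Pi.zero_apply, sub_zero] at h5
  refine h5.congr' ?_
  filter_upwards [eventually_gt_atTop 0] with T hT
  have : (T : ℝ) ≠ 0 := by positivity
  simp_rw [hs]
  rw [Finset.sum_sub_distrib, Finset.sum_const, Finset.card_range, nsmul_eq_mul]
  field_simp

/-- The auxiliary `w` is not determined, but `g` and `h` are limits depending only on `R` and `c`.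
-/
theorem unique (hR : R ∈ rowStochastic ℝ S) (H : ExactTCE c R g h) (H' : ExactTCE c R g' h') :
    g = g' ∧ h = h' := by
  obtain ⟨M, hM⟩ := exists_isErgodicLimit hR
  obtain rfl : g = g' := (H.gain_eq hM).trans (H'.gain_eq hM).symm
  exact ⟨rfl, funext fun s => tendsto_nhds_unique (H.isBias hR s) (H'.isBias hR s)⟩

end ExactTCE

end Ergodic

/-! ### Strict improvement of gain and bias. -/

section PolicyIteration

theorem mulVec_eq_of_row_eq {S : Type*} [Fintype S] {R R' : Matrix S S ℝ} {A : Set S}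
    (hrow : ∀ s ∈ A, R' s = R s)
    (hA : ∀ s ∈ A, ∀ s', R' s s' ≠ 0 → s' ∈ A) {f f' : S → ℝ} (hf : ∀ s ∈ A, f' s = f s) :
    ∀ s ∈ A, (R' *ᵥ f') s = (R *ᵥ f) s := by
  intro s hs
  refine Finset.sum_congr rfl fun s' _ => ?_
  rw [← hrow s hs]
  by_cases h0 : R' s s' = 0
  · simp [h0]
  · rw [hf s' (hA s hs s' h0)]

variable {S : Type*} [Fintype S] [DecidableEq S] {R R' M' : Matrix S S ℝ} {c g h g' h' : S → ℝ}

theorem pow_mulVec_eq_of_row_eq {A : Set S} (hrow : ∀ s ∈ A, R' s = R s)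
    (hA : ∀ s ∈ A, ∀ s', R' s s' ≠ 0 → s' ∈ A) {f f' : S → ℝ} (hf : ∀ s ∈ A, f' s = f s)
    (t : ℕ) : ∀ s ∈ A, ((R' ^ t) *ᵥ f') s = ((R ^ t) *ᵥ f) s := by
  induction t with
  | zero => simpa using hf
  | succ t ih =>
    rw [pow_succ', pow_succ', ← mulVec_mulVec, ← mulVec_mulVec]
    exact mulVec_eq_of_row_eq hrow hA ih

/-- Gain and bias on a closed set of states depend only on the rows of these states. -/
theorem ExactTCE.eq_of_row_eq (hR : R ∈ rowStochastic ℝ S) (hR' : R' ∈ rowStochastic ℝ S)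
    (H : ExactTCE c R g h) (H' : ExactTCE c R' g' h') {A : Set S}
    (hrow : ∀ s ∈ A, R' s = R s) (hA : ∀ s ∈ A, ∀ s', R' s s' ≠ 0 → s' ∈ A) :
    (∀ s ∈ A, g' s = g s) ∧ ∀ s ∈ A, h' s = h s := by
  obtain ⟨M, hM⟩ := exists_isErgodicLimit hR
  obtain ⟨M', hM'⟩ := exists_isErgodicLimit hR'
  have hg : ∀ s ∈ A, g' s = g s := by
    intro s hs
    rw [H.gain_eq hM, H'.gain_eq hM']
    refine tendsto_nhds_unique (hM'.tendsto c s) ((hM.tendsto c s).congr fun T => ?_)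
    congr 1
    exact Finset.sum_congr rfl fun t _ =>
      (pow_mulVec_eq_of_row_eq hrow hA (fun _ _ => rfl) t s hs).symm
  refine ⟨hg, fun s hs => ?_⟩
  refine tendsto_nhds_unique (H'.isBias hR' s) ((H.isBias hR s).congr fun T => ?_)
  congr 1
  refine Finset.sum_congr rfl fun n _ => Finset.sum_congr rfl fun t _ => ?_
  refine (pow_mulVec_eq_of_row_eq hrow hA (fun s hs => ?_) t s hs).symm
  simp [hg s hs]

/-- The recurrent states: those charged by the ergodic limit. -/
def recurrentStates (M : Matrix S S ℝ) : Set S := {s' | ∃ s, 0 < M s s'}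

/-- Since `M' R' = M'`, mass at a charged state is carried to each of its successors. -/
theorem IsErgodicLimit.recurrentStates_closed (hM : IsErgodicLimit R' M') :
    ∀ s ∈ recurrentStates M', ∀ s', R' s s' ≠ 0 → s' ∈ recurrentStates M' := by
  rintro s ⟨s₀, hs⟩ s' h0
  refine ⟨s₀, ?_⟩
  have h1 : 0 < R' s s' := lt_of_le_of_ne (hM.stochastic.1 _ _) (Ne.symm h0)
  rw [← hM.limit_mul, mul_apply]
  exact (mul_pos hs h1).trans_le (Finset.single_le_sum (f := fun j => M' s₀ j * R' j s')
    (fun j _ => mul_nonneg (hM.limit_nonneg _ _) (hM.stochastic.1 _ _)) (Finset.mem_univ s))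

theorem IsErgodicLimit.eq_zero_of_mulVec_eq_zero (hM : IsErgodicLimit R' M') {u : S → ℝ}
    (hu : 0 ≤ u) (h0 : M' *ᵥ u = 0) : ∀ s ∈ recurrentStates M', u s = 0 := by
  rintro s ⟨s₀, hs⟩
  have h1 : ∑ j, M' s₀ j * u j = 0 := congrFun h0 s₀
  rw [Finset.sum_eq_zero_iff_of_nonneg
    fun j _ => mul_nonneg (hM.limit_nonneg _ _) (hu j)] at h1
  exact (mul_eq_zero.1 (h1 s (Finset.mem_univ s))).resolve_left hs.ne'

theorem IsErgodicLimit.mulVec_congr (hM : IsErgodicLimit R' M') {f f' : S → ℝ}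
    (hf : ∀ s ∈ recurrentStates M', f s = f' s) : M' *ᵥ f = M' *ᵥ f' := by
  funext s
  refine Finset.sum_congr rfl fun s' _ => ?_
  rcases (hM.limit_nonneg s s').eq_or_lt with h0 | h0
  · simp [← h0]
  · rw [hf s' ⟨s, h0⟩]

/-- An improvement of the gain. -/
theorem ExactTCE.gain_lt_of_gain_improvement (hR : R ∈ rowStochastic ℝ S)
    (hR' : R' ∈ rowStochastic ℝ S) (H : ExactTCE c R g h) (H' : ExactTCE c R' g' h')
    (hle : R' *ᵥ g ≤ R *ᵥ g) (hne : R' *ᵥ g ≠ R *ᵥ g)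
    (hkeep : ∀ s, (R' *ᵥ g) s = (R *ᵥ g) s → R' s = R s) : g' < g := by
  obtain ⟨M', hM'⟩ := exists_isErgodicLimit hR'
  rw [H.gain_fixed] at hle hne hkeep
  -- The one-step decrease of `g` is nonnegative and killed by `M'`, because `M' R' = M'`; so it
  -- lives on the transient states.
  have hu := hM'.eq_zero_of_mulVec_eq_zero (u := g - R' *ᵥ g) (sub_nonneg.2 hle)
    (by rw [mulVec_sub, hM'.mulVec_mulVec_right, sub_self])
  have hrow : ∀ s ∈ recurrentStates M', R' s = R s := fun s hs =>
    hkeep s (sub_eq_zero.1 (hu s hs)).symm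
  -- With unchanged rows on the closed recurrent class, `g'` and `g` agree there. Hence `g' = M' g'
  -- = M' g`, which lies below `g` as `R' g ≤ g`.
  have hrec := (H.eq_of_row_eq hR hR' H' hrow hM'.recurrentStates_closed).1
  have hg' : g' = M' *ᵥ g :=
    (hM'.mulVec_of_fixed H'.gain_fixed).symm.trans (hM'.mulVec_congr hrec)
  refine lt_of_le_of_ne (hg' ▸ hM'.mulVec_le hle) ?_
  rintro rfl
  exact hne H'.gain_fixed

/-- An improvement of the bias. -/
theorem ExactTCE.lex_lt_of_bias_improvement (hR : R ∈ rowStochastic ℝ S)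
    (hR' : R' ∈ rowStochastic ℝ S) (H : ExactTCE c R g h) (H' : ExactTCE c R' g' h')
    (hgain : R' *ᵥ g = g) (hle : R' *ᵥ h ≤ R *ᵥ h) (hne : R' *ᵥ h ≠ R *ᵥ h)
    (hkeep : ∀ s, (R' *ᵥ h) s = (R *ᵥ h) s → R' s = R s) : g' < g ∨ g' = g ∧ h' < h := by
  obtain ⟨M', hM'⟩ := exists_isErgodicLimit hR'
  set v := R *ᵥ h - R' *ᵥ h with hv
  have hv0 : 0 ≤ v := sub_nonneg.2 hle
  -- The Poisson equation of `R` rewritten for `R'`, with defect `v`. Applying `M'` gives `g' = g -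
  -- M' v`.
  have hc : c = g + (1 - R') *ᵥ h - v := by
    rw [hv, sub_mulVec, one_mulVec, eq_sub_of_add_eq H.cost_eq.symm]
    abel
  have hg' : g' = g - M' *ᵥ v := by
    conv_lhs => rw [H'.gain_eq hM', hc, mulVec_sub, mulVec_add, hM'.mulVec_one_sub,
      hM'.mulVec_of_fixed hgain, add_zero]
  have hle' : g' ≤ g := by
    rw [hg']
    exact sub_le_self _ fun s =>
      Finset.sum_nonneg fun j _ => mul_nonneg (hM'.limit_nonneg s j) (hv0 j)
  refine hle'.lt_or_eq.imp_right fun hgg => ⟨hgg, ?_⟩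
  have hMv : M' *ᵥ v = 0 := by rwa [hgg, eq_comm, sub_eq_self] at hg'
  have hrow : ∀ s ∈ recurrentStates M', R' s = R s := fun s hs =>
    hkeep s (sub_eq_zero.1 (hM'.eq_zero_of_mulVec_eq_zero hv0 hMv s hs)).symm
  have hrec := (H.eq_of_row_eq hR hR' H' hrow hM'.recurrentStates_closed).2
  -- With equal gains, `h' - h` is subharmonic for `R'` and zero on the recurrent states, so it lies
  -- below its limit `0`.
  have hd : h' - h = R' *ᵥ (h' - h) - v := by
    have h1 := H'.cost_eq
    have h2 := H.cost_eq
    rw [hgg] at h1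
    have h3 : h' = c + R' *ᵥ h' - g := eq_sub_of_add_eq' h1
    have h4 : h = c + R *ᵥ h - g := eq_sub_of_add_eq' h2
    conv_lhs => rw [h3, h4]
    rw [mulVec_sub, hv]
    abel
  have hMd : M' *ᵥ (h' - h) = 0 := by
    rw [hM'.mulVec_congr (f' := 0) (fun s hs => by simp [hrec s hs]), mulVec_zero]
  have hhle : h' ≤ h := by
    have := hM'.le_mulVec (f := h' - h) (by
      conv_lhs => rw [hd]
      exact sub_le_self _ hv0)
    rw [hMd] at this
    exact sub_nonpos.1 this
  refine lt_of_le_of_ne hhle ?_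
  rintro rfl
  rw [sub_self, mulVec_zero, zero_sub, zero_eq_neg] at hd
  exact hne (sub_eq_zero.1 (hv ▸ hd)).symm

end PolicyIteration

/-! ### Vertices of the coupling polytope. -/

section Couplings

variable {X Y : Type*} [Fintype X] [Fintype Y] {μ : X → ℝ} {ν : Y → ℝ}

theorem le_of_mem_couplings {r : X × Y → ℝ} (hr : r ∈ couplings μ ν) (s : X × Y) :
    r s ≤ μ s.1 := by
  rw [← hr.2.1 s.1]
  exact Finset.single_le_sum (f := fun y => r (s.1, y)) (fun y _ => hr.1 _) (Finset.mem_univ s.2)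

theorem le_of_mem_couplings' {r : X × Y → ℝ} (hr : r ∈ couplings μ ν) (s : X × Y) :
    r s ≤ ν s.2 := by
  rw [← hr.2.2 s.2]
  exact Finset.single_le_sum (f := fun x => r (x, s.2)) (fun y _ => hr.1 _) (Finset.mem_univ s.1)

theorem sum_of_mem_couplings {r : X × Y → ℝ} (hr : r ∈ couplings μ ν) :
    ∑ s, r s = ∑ x, μ x := by
  rw [Fintype.sum_prod_type]
  exact Finset.sum_congr rfl fun x _ => hr.2.1 x

theorem isCompact_couplings : IsCompact (couplings μ ν) := by
  refine (isCompact_Icc (a := (0 : X × Y → ℝ)) (b := fun s => μ s.1)).of_isClosed_subset ?_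
    fun r hr => ⟨hr.1, le_of_mem_couplings hr⟩
  refine IsClosed.inter (s₁ := {r : X × Y → ℝ | ∀ s, 0 ≤ r s}) ?_ (IsClosed.inter
    (s₁ := {r : X × Y → ℝ | ∀ x, ∑ y, r (x, y) = μ x}) (s₂ := {r | ∀ y, ∑ x, r (x, y) = ν y})
    ?_ ?_)
  · simp only [Set.ofPred_forall]
    exact isClosed_iInter fun s => isClosed_le continuous_const (continuous_apply s)
  · simp only [Set.ofPred_forall]
    exact isClosed_iInter fun s => isClosed_eq (by fun_prop) continuous_const
  · simp only [Set.ofPred_forall]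
    exact isClosed_iInter fun s => isClosed_eq (by fun_prop) continuous_const

theorem product_mem_couplings (hμ : ∀ x, 0 ≤ μ x) (hμ1 : ∑ x, μ x = 1) (hν : ∀ y, 0 ≤ ν y)
    (hν1 : ∑ y, ν y = 1) : (fun s : X × Y => μ s.1 * ν s.2) ∈ couplings μ ν := by
  refine ⟨fun s => mul_nonneg (hμ _) (hν _), fun x => ?_, fun y => ?_⟩
  · simp [← Finset.mul_sum, hν1]
  · simp [← Finset.sum_mul, hμ1]

/-- A vertex of the coupling polytope is the only coupling with support in its support. -/
theorem eq_of_mem_extremePoints_couplings {r r' : X × Y → ℝ}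
    (hr : r ∈ Set.extremePoints ℝ (couplings μ ν)) (hr' : r' ∈ couplings μ ν)
    (h : ∀ s, r s = 0 → r' s = 0) : r' = r := by
  have hrm := hr.1
  -- One can move from `r` a little along `±(r' - r)`: a coordinate where `r` vanishes does not
  -- move, and the others are positive.
  have key : ∀ σ : ℝ, ∀ᶠ ε : ℝ in 𝓝[>] 0, ∀ s, 0 ≤ r s + σ * ε * (r' s - r s) := by
    intro σ
    refine eventually_all.2 fun s => ?_
    rcases (hrm.1 s).eq_or_lt with h0 | h0
    · refine Eventually.of_forall fun ε => ?_
      rw [h s h0.symm, ← h0]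
      simp
    · have hc : Continuous fun ε : ℝ => r s + σ * ε * (r' s - r s) := by fun_prop
      have ht := hc.tendsto 0
      simp only [mul_zero, zero_mul, add_zero] at ht
      filter_upwards [(ht.mono_left nhdsWithin_le_nhds).eventually (lt_mem_nhds h0)] with ε hε
      exact hε.le
  obtain ⟨ε, ⟨h1, h2⟩, hε⟩ := (((key 1).and (key (-1))).and self_mem_nhdsWithin).exists
  have hmem : ∀ σ : ℝ, (∀ s, 0 ≤ r s + σ * ε * (r' s - r s)) →
      (fun s => r s + σ * ε * (r' s - r s)) ∈ couplings μ ν := by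
    refine fun σ hσ => ⟨hσ, fun x => ?_, fun y => ?_⟩
    · rw [Finset.sum_add_distrib, ← Finset.mul_sum, Finset.sum_sub_distrib, hrm.2.1, hr'.2.1,
        sub_self, mul_zero, add_zero]
    · rw [Finset.sum_add_distrib, ← Finset.mul_sum, Finset.sum_sub_distrib, hrm.2.2, hr'.2.2,
        sub_self, mul_zero, add_zero]
  -- The vertex `r` is the midpoint of the two displaced couplings.
  have := hr.2 (hmem 1 h1) (hmem (-1) h2)
    ⟨1 / 2, 1 / 2, by norm_num, by norm_num, by norm_num, by
      funext s
      simp only [Pi.add_apply, Pi.smul_apply, smul_eq_mul]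
      ring⟩
  funext s
  have hs := congrFun this s
  have hε' : (0 : ℝ) < ε := hε
  have : ε * (r' s - r s) = 0 := by linarith
  have := (mul_eq_zero.1 this).resolve_left hε'.ne'
  linarith

/-- A vertex is determined by its zero set, and there are finitely many zero sets. -/
theorem finite_extremePoints_couplings :
    (Set.extremePoints ℝ (couplings μ ν)).Finite := by
  refine Set.Finite.of_finite_image (f := fun r => {s | r s = 0}) (Set.toFinite _) ?_
  intro r hr r' hr' h
  refine (eq_of_mem_extremePoints_couplings hr hr'.1 fun s hs => ?_).symm
  have h' : {s | r s = 0} = {s | r' s = 0} := h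
  exact (Set.ext_iff.1 h' s).1 hs

/-- The optimal couplings form a nonempty compact exposed face. It has an extreme point, and an
extreme point of a face is one of the whole polytope. -/
theorem exists_optimal_vertex (hne : (couplings μ ν).Nonempty) (f : X × Y → ℝ) :
    ∃ r ∈ otSolutions μ ν f, r ∈ Set.extremePoints ℝ (couplings μ ν) := by
  have hex : IsExposed ℝ (couplings μ ν) (otSolutions μ ν f) := by
    intro _
    -- Exposed faces are defined by maximization, hence the sign.
    refine ⟨-(∑ s, f s • (ContinuousLinearMap.proj s : (X × Y → ℝ) →L[ℝ] ℝ)), ?_⟩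
    ext r
    simp [otSolutions, dotProduct, mul_comm]
  have hne' : (otSolutions μ ν f).Nonempty := by
    obtain ⟨r, hr, hmin⟩ := isCompact_couplings.exists_isMinOn hne
      (f := fun r : X × Y → ℝ => r ⬝ᵥ f) (by unfold dotProduct; fun_prop)
    exact ⟨r, hr, fun r' hr' => hmin hr'⟩
  obtain ⟨r, hr⟩ := (hex.isCompact isCompact_couplings).extremePoints_nonempty hne'
  exact ⟨r, hr.1, hex.isExtreme.extremePoints_subset_extremePoints hr⟩

end Couplings

/-! ### Transition couplings exist and are stochastic. -/

section TransitionCouplings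

variable {X Y : Type*} [Fintype X] [DecidableEq X] [Fintype Y] [DecidableEq Y]
  {P : Matrix X X ℝ} {Q : Matrix Y Y ℝ}

theorem stochastic_of_mem_transitionCouplings (hP : P ∈ rowStochastic ℝ X)
    {R : Matrix (X × Y) (X × Y) ℝ} (hR : R ∈ transitionCouplings P Q) :
    R ∈ rowStochastic ℝ (X × Y) :=
  mem_rowStochastic_iff_sum.2 ⟨fun s s' => (hR s).1 s', fun s =>
    (sum_of_mem_couplings (hR s)).trans (sum_row_of_mem_rowStochastic hP s.1)⟩

theorem kronecker_mem_transitionCouplings (hP : P ∈ rowStochastic ℝ X)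
    (hQ : Q ∈ rowStochastic ℝ Y) : P ⊗ₖ Q ∈ transitionCouplings P Q := fun s =>
  product_mem_couplings (hP.1 s.1) (sum_row_of_mem_rowStochastic hP s.1) (hQ.1 s.2)
    (sum_row_of_mem_rowStochastic hQ s.2)

theorem exists_isElemArgmin (hP : P ∈ rowStochastic ℝ X) (hQ : Q ∈ rowStochastic ℝ Y)
    (f : X × Y → ℝ) (R₀ : Matrix (X × Y) (X × Y) ℝ) : ∃ R', IsElemArgmin P Q f R₀ R' := by
  have : ∀ s : X × Y, ∃ r : X × Y → ℝ, r ∈ otSolutions (P s.1) (Q s.2) f ∧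
      r ∈ Set.extremePoints ℝ (couplings (P s.1) (Q s.2)) ∧
      (R₀ s ∈ otSolutions (P s.1) (Q s.2) f →
        R₀ s ∈ Set.extremePoints ℝ (couplings (P s.1) (Q s.2)) → r = R₀ s) := by
    intro s
    by_cases h : R₀ s ∈ otSolutions (P s.1) (Q s.2) f ∧
        R₀ s ∈ Set.extremePoints ℝ (couplings (P s.1) (Q s.2))
    · exact ⟨R₀ s, h.1, h.2, fun _ _ => rfl⟩
    · obtain ⟨r, h1, h2⟩ := exists_optimal_vertex
        ⟨_, kronecker_mem_transitionCouplings hP hQ s⟩ f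
      exact ⟨r, h1, h2, fun h3 h4 => (h ⟨h3, h4⟩).elim⟩
  choose R' hR' using this
  exact ⟨R', hR'⟩

end TransitionCouplings

/-! ### A gain that cannot be decreased is harmonic for all transition couplings. -/

section Harmonic

/-- A subharmonic function of a chain with a positive stationary distribution is constant along
the transitions of the chain. -/
theorem eq_of_le_mulVec {S : Type*} [Fintype S] [DecidableEq S] {K : Matrix S S ℝ}
    (hK : K ∈ rowStochastic ℝ S) {π : S → ℝ} (hπ : ∀ s, 0 < π s) (hst : π ᵥ* K = π) {g : S → ℝ}
    (hg : g ≤ K *ᵥ g) {s s' : S} (hs : K s s' ≠ 0) : g s' = g s := by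
  have hinv : ∀ f : S → ℝ, ∑ s, π s * (K *ᵥ f) s = ∑ s, π s * f s := fun f =>
    (dotProduct_mulVec π K f).trans (by rw [hst]; rfl)
  -- Integrating `K g - g ≥ 0` against the positive invariant `π` gives zero.
  have hharm : K *ᵥ g = g := by
    have h0 : ∑ s, π s * ((K *ᵥ g) s - g s) = 0 := by
      simp_rw [mul_sub, Finset.sum_sub_distrib, hinv, sub_self]
    rw [Finset.sum_eq_zero_iff_of_nonneg
      fun s _ => mul_nonneg (hπ s).le (sub_nonneg.2 (hg s))] at h0
    funext s
    exact sub_eq_zero.1 ((mul_eq_zero.1 (h0 s (Finset.mem_univ s))).resolve_left (hπ s).ne')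
  -- The conditional variance of `g` along a step; by invariance its `π`-integral is zero too.
  have hrow : ∀ s, ∑ s', K s s' * (g s' - g s) ^ 2 = (K *ᵥ fun s => g s ^ 2) s - g s ^ 2 := by
    intro s
    have h1 : ∑ s', K s s' * g s' = g s := congrFun hharm s
    have h2 := sum_row_of_mem_rowStochastic hK s
    calc ∑ s', K s s' * (g s' - g s) ^ 2
        = ∑ s', (K s s' * g s' ^ 2 - 2 * g s * (K s s' * g s') + g s ^ 2 * K s s') :=
          Finset.sum_congr rfl fun s' _ => by ring
      _ = _ := by
          rw [Finset.sum_add_distrib, Finset.sum_sub_distrib, ← Finset.mul_sum, ← Finset.mul_sum,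
            h1, h2]
          simp only [mulVec, dotProduct]
          ring
  have h0 : ∑ s, π s * ∑ s', K s s' * (g s' - g s) ^ 2 = 0 := by
    simp_rw [hrow, mul_sub, Finset.sum_sub_distrib, hinv, sub_self]
  have hn : ∀ s s', 0 ≤ K s s' * (g s' - g s) ^ 2 := fun s s' =>
    mul_nonneg (hK.1 s s') (sq_nonneg _)
  rw [Finset.sum_eq_zero_iff_of_nonneg
    fun s _ => mul_nonneg (hπ s).le (Finset.sum_nonneg fun s' _ => hn s s')] at h0
  have h1 := (mul_eq_zero.1 (h0 s (Finset.mem_univ s))).resolve_left (hπ s).ne'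
  rw [Finset.sum_eq_zero_iff_of_nonneg fun s' _ => hn s s'] at h1
  have h2 := (mul_eq_zero.1 (h1 s' (Finset.mem_univ s'))).resolve_left hs
  exact sub_eq_zero.1 (pow_eq_zero_iff two_ne_zero |>.1 h2)

theorem vecMul_kronecker_of_stationary {X Y : Type*} [Fintype X] [Fintype Y]
    {P : Matrix X X ℝ} {Q : Matrix Y Y ℝ} {p : X → ℝ} {q : Y → ℝ} (hp : p ᵥ* P = p) (hq : q ᵥ* Q = q) :
    (fun s : X × Y => p s.1 * q s.2) ᵥ* (P ⊗ₖ Q) = fun s => p s.1 * q s.2 := by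
  funext s
  calc ((fun s : X × Y => p s.1 * q s.2) ᵥ* (P ⊗ₖ Q)) s
      = (∑ x, p x * P x s.1) * ∑ y, q y * Q y s.2 := by
        simp only [vecMul, dotProduct, kroneckerMap_apply]
        rw [Fintype.sum_prod_type, Finset.sum_mul_sum]
        exact Finset.sum_congr rfl fun x _ => Finset.sum_congr rfl fun y _ => by ring
    _ = p s.1 * q s.2 := congrArg₂ (· * ·) (congrFun hp s.1) (congrFun hq s.2)

variable {X Y : Type*} [Fintype X] [DecidableEq X] [Fintype Y] [DecidableEq Y]
  {P : Matrix X X ℝ} {Q : Matrix Y Y ℝ} {p : X → ℝ} {q : Y → ℝ}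

/-- If no transition coupling decreases `g`, then `g` is harmonic for all of them. -/
theorem mulVec_eq_of_le_transitionCouplings (hP : P ∈ rowStochastic ℝ X)
    (hQ : Q ∈ rowStochastic ℝ Y) (hp : ∀ x, 0 < p x) (hq : ∀ y, 0 < q y) (hpP : p ᵥ* P = p)
    (hqQ : q ᵥ* Q = q) {g : X × Y → ℝ} (hg : ∀ R ∈ transitionCouplings P Q, g ≤ R *ᵥ g)
    {R : Matrix (X × Y) (X × Y) ℝ} (hR : R ∈ transitionCouplings P Q) : R *ᵥ g = g := by
  have hK := kronecker_mem_transitionCouplings hP hQ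
  funext s
  calc (R *ᵥ g) s = ∑ s', R s s' * g s := by
        refine Finset.sum_congr rfl fun s' _ => ?_
        by_cases h0 : R s s' = 0
        · simp [h0]
        · have hpos : 0 < R s s' := lt_of_le_of_ne ((hR s).1 s') (Ne.symm h0)
          have hPs := hpos.trans_le (le_of_mem_couplings (hR s) s')
          have hQs := hpos.trans_le (le_of_mem_couplings' (hR s) s')
          -- A coupling is bounded by both marginals, so wherever it is positive the product is
          -- positive.
          rw [eq_of_le_mulVec (stochastic_of_mem_transitionCouplings hP hK)
            (fun s => mul_pos (hp s.1) (hq s.2)) (vecMul_kronecker_of_stationary hpP hqQ)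
            (hg _ hK) (s := s) (s' := s') (mul_pos hPs hQs).ne']
    _ = g s := by
        rw [← Finset.sum_mul, sum_row_of_mem_rowStochastic
          (stochastic_of_mem_transitionCouplings hP hR), one_mul]

end Harmonic

/-! ### Runs of the algorithm and their termination. -/

section Run

variable {X Y : Type*} [Fintype X] [Fintype Y]
  {P : Matrix X X ℝ} {Q : Matrix Y Y ℝ} {p : X → ℝ} {q : Y → ℝ} {c f g h g₁ h₁ : X × Y → ℝ}
  {R R₁ R' : Matrix (X × Y) (X × Y) ℝ}

theorem IsElemArgmin.mem (H : IsElemArgmin P Q f R R') : R' ∈ transitionCouplings P Q :=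
  fun s => (H s).1.1

theorem IsElemArgmin.mulVec_le (H : IsElemArgmin P Q f R R') (hR₁ : R₁ ∈ transitionCouplings P Q) :
    R' *ᵥ f ≤ R₁ *ᵥ f :=
  fun s => (H s).1.2 _ (hR₁ s)

/-- This is what the tie-breaking rule is for: a state without strict improvement keeps its row, the
old row being an optimal vertex. -/
theorem IsElemArgmin.row_eq (H : IsElemArgmin P Q f R R') (hR : R ∈ transitionCouplings P Q)
    (hv : ∀ s, R s ∈ Set.extremePoints ℝ (couplings (P s.1) (Q s.2))) (s : X × Y)
    (hs : (R' *ᵥ f) s = (R *ᵥ f) s) : R' s = R s :=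
  (H s).2.2 ⟨hR s, fun r hr => hs.symm.le.trans ((H s).1.2 r hr)⟩ (hv s)

theorem ExactTCI.mem (H : ExactTCI P Q g h R R₁) (hR : R ∈ transitionCouplings P Q) :
    R₁ ∈ transitionCouplings P Q := by
  obtain ⟨R', hR', ⟨-, rfl⟩ | ⟨-, R'', hR'', ⟨-, rfl⟩ | ⟨-, rfl⟩⟩⟩ := H
  exacts [hR'.mem, hR, hR''.mem]

theorem ExactTCI.extreme_of_ne (H : ExactTCI P Q g h R R₁) (hne : R₁ ≠ R) (s : X × Y) :
    R₁ s ∈ Set.extremePoints ℝ (couplings (P s.1) (Q s.2)) := by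
  obtain ⟨R', hR', ⟨-, rfl⟩ | ⟨-, R'', hR'', ⟨-, rfl⟩ | ⟨-, rfl⟩⟩⟩ := H
  exacts [(hR' s).2.1, (hne rfl).elim, (hR'' s).2.1]

/-- A matrix that the improvement step returns unchanged is optimal for both functions. -/
theorem ExactTCI.minimal_of_eq (H : ExactTCI P Q g h R R) :
    (∀ R₁ ∈ transitionCouplings P Q, R *ᵥ g ≤ R₁ *ᵥ g) ∧
      ∀ R₁ ∈ transitionCouplings P Q, R *ᵥ h ≤ R₁ *ᵥ h := by
  obtain ⟨R', hR', ⟨h1, h2⟩ | ⟨h1, R'', hR'', ⟨h2, -⟩ | ⟨h2, h3⟩⟩⟩ := H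
  · exact (h1 (by rw [← h2])).elim
  · exact ⟨fun R₁ hR₁ => h1 ▸ hR'.mulVec_le hR₁, fun R₁ hR₁ => h2 ▸ hR''.mulVec_le hR₁⟩
  · exact (h2 (by rw [← h3])).elim

theorem ExactTCI.eq_of_minimal (H : ExactTCI P Q g h R R₁) (hR : R ∈ transitionCouplings P Q)
    (hg : ∀ R₁ ∈ transitionCouplings P Q, R *ᵥ g ≤ R₁ *ᵥ g)
    (hh : ∀ R₁ ∈ transitionCouplings P Q, R *ᵥ h ≤ R₁ *ᵥ h) : R₁ = R := by
  obtain ⟨R', hR', ⟨h1, h2⟩ | ⟨h1, R'', hR'', ⟨h2, h3⟩ | ⟨h2, h3⟩⟩⟩ := H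
  · exact (h1 ((hR'.mulVec_le hR).antisymm (hg _ hR'.mem))).elim
  · exact h3
  · exact (h2 ((hR''.mulVec_le hR).antisymm (hh _ hR''.mem))).elim

variable [DecidableEq X] [DecidableEq Y]

theorem exists_exactTCI (hP : P ∈ rowStochastic ℝ X) (hQ : Q ∈ rowStochastic ℝ Y)
    (g h : X × Y → ℝ) (R : Matrix (X × Y) (X × Y) ℝ) : ∃ R₁, ExactTCI P Q g h R R₁ := by
  obtain ⟨R', hR'⟩ := exists_isElemArgmin hP hQ g R
  obtain ⟨R'', hR''⟩ := exists_isElemArgmin hP hQ h R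
  by_cases h1 : R' *ᵥ g = R *ᵥ g
  · by_cases h2 : R'' *ᵥ h = R *ᵥ h
    · exact ⟨R, R', hR', Or.inr ⟨h1, R'', hR'', Or.inl ⟨h2, rfl⟩⟩⟩
    · exact ⟨R'', R', hR', Or.inr ⟨h1, R'', hR'', Or.inr ⟨h2, rfl⟩⟩⟩
  · exact ⟨R', R', hR', Or.inl ⟨h1, rfl⟩⟩

/-- A nontrivial iteration from a matrix with vertex rows decreases gain and bias
lexicographically. -/
theorem ExactTCI.lex_lt (hP : P ∈ rowStochastic ℝ X) (hQ : Q ∈ rowStochastic ℝ Y)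
    (hp : ∀ x, 0 < p x) (hq : ∀ y, 0 < q y) (hpP : p ᵥ* P = p) (hqQ : q ᵥ* Q = q)
    (hR : R ∈ transitionCouplings P Q)
    (hv : ∀ s, R s ∈ Set.extremePoints ℝ (couplings (P s.1) (Q s.2)))
    (H : ExactTCI P Q g h R R₁) (hE : ExactTCE c R g h) (hE₁ : ExactTCE c R₁ g₁ h₁)
    (hne : R₁ ≠ R) : g₁ < g ∨ g₁ = g ∧ h₁ < h := by
  have hR₁ := stochastic_of_mem_transitionCouplings hP (H.mem hR)
  have hRs := stochastic_of_mem_transitionCouplings hP hR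
  obtain ⟨R', hR', ⟨h1, rfl⟩ | ⟨h1, R'', hR'', ⟨-, h3⟩ | ⟨h2, rfl⟩⟩⟩ := H
  · exact Or.inl (hE.gain_lt_of_gain_improvement hRs hR₁ hE₁ (hR'.mulVec_le hR) h1
      (hR'.row_eq hR hv))
  · exact (hne h3).elim
  · refine hE.lex_lt_of_bias_improvement hRs hR₁ hE₁ ?_ (hR''.mulVec_le hR) h2
      (hR''.row_eq hR hv)
    -- The new matrix minimizes only the bias, over all transition couplings. That it preserves the
    -- gain comes from harmonicity.
    refine mulVec_eq_of_le_transitionCouplings hP hQ hp hq hpP hqQ (fun R₂ hR₂ => ?_) hR''.mem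
    exact (hE.gain_fixed.symm.trans h1.symm).trans_le (hR'.mulVec_le hR₂)

theorem exists_isExactOTCRun (hP : P ∈ rowStochastic ℝ X) (hQ : Q ∈ rowStochastic ℝ Y)
    (c : X × Y → ℝ) : ∃ g h R, IsExactOTCRun P Q c g h R := by
  have hstep : ∀ R : transitionCouplings P Q, ∃ (g h : X × Y → ℝ) (R₁ : transitionCouplings P Q),
      ExactTCE c R.1 g h ∧ ExactTCI P Q g h R.1 R₁.1 := by
    intro R
    obtain ⟨g, h, hE⟩ := exists_exactTCE (stochastic_of_mem_transitionCouplings hP R.2) c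
    obtain ⟨R₁, hI⟩ := exists_exactTCI hP hQ g h R.1
    exact ⟨g, h, ⟨R₁, hI.mem R.2⟩, hE, hI⟩
  choose G H N hE hI using hstep
  let ρ : ℕ → transitionCouplings P Q :=
    fun n => N^[n] ⟨P ⊗ₖ Q, kronecker_mem_transitionCouplings hP hQ⟩
  refine ⟨fun n => G (ρ n), fun n => H (ρ n), fun n => (ρ n).1, rfl, fun n => hE _, fun n => ?_⟩
  have : ρ (n + 1) = N (ρ n) := Function.iterate_succ_apply' N n _
  rw [this]
  exact hI _

namespace IsExactOTCRun

variable {g h : ℕ → X × Y → ℝ} {R : ℕ → Matrix (X × Y) (X × Y) ℝ}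

theorem mem (H : IsExactOTCRun P Q c g h R) (hP : P ∈ rowStochastic ℝ X)
    (hQ : Q ∈ rowStochastic ℝ Y) (n : ℕ) : R n ∈ transitionCouplings P Q := by
  induction n with
  | zero => exact H.init ▸ kronecker_mem_transitionCouplings hP hQ
  | succ n ih => exact (H.improvement n).mem ih

theorem exists_succ_eq (H : IsExactOTCRun P Q c g h R) (hP : P ∈ rowStochastic ℝ X)
    (hQ : Q ∈ rowStochastic ℝ Y) (hp : ∀ x, 0 < p x) (hq : ∀ y, 0 < q y) (hpP : p ᵥ* P = p)
    (hqQ : q ᵥ* Q = q) : ∃ n, R (n + 1) = R n := by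
  by_contra! hne
  have hv : ∀ n s, R (n + 1) s ∈ Set.extremePoints ℝ (couplings (P s.1) (Q s.2)) := fun n =>
    (H.improvement n).extreme_of_ne (hne n)
  -- The index starts at one because the rows of `R 0 = P ⊗ₖ Q` may fail to be vertices.
  have hanti : StrictAnti fun n => toLex (g (n + 1), h (n + 1)) :=
    strictAnti_nat_of_succ_lt fun n => Prod.Lex.toLex_lt_toLex.2 <|
      (H.improvement (n + 1)).lex_lt hP hQ hp hq hpP hqQ (H.mem hP hQ _) (hv n)
        (H.evaluation _) (H.evaluation _) (hne _)
  have hinj : Function.Injective fun n => R (n + 1) := by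
    intro m n hmn
    have hE := H.evaluation (n + 1)
    rw [← show R (m + 1) = R (n + 1) from hmn] at hE
    obtain ⟨h1, h2⟩ := (H.evaluation (m + 1)).unique
      (stochastic_of_mem_transitionCouplings hP (H.mem hP hQ _)) hE
    refine hanti.injective ?_
    change toLex (g (m + 1), h (m + 1)) = toLex (g (n + 1), h (n + 1))
    rw [h1, h2]
  have hfin : (Set.univ.pi fun s : X × Y =>
      Set.extremePoints ℝ (couplings (P s.1) (Q s.2))).Finite :=
    Set.Finite.pi fun _ => finite_extremePoints_couplings
  exact Set.infinite_of_injective_forall_mem hinj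
    (fun n => Set.mem_univ_pi.2 fun s => hv n s) hfin

/-- A run becomes stationary, at a matrix that is optimal for its gain and its bias. -/
theorem exists_forall_eq (H : IsExactOTCRun P Q c g h R) (hP : P ∈ rowStochastic ℝ X)
    (hQ : Q ∈ rowStochastic ℝ Y) (hp : ∀ x, 0 < p x) (hq : ∀ y, 0 < q y) (hpP : p ᵥ* P = p)
    (hqQ : q ᵥ* Q = q) : ∃ N, (∀ n ≥ N, g n = g N ∧ h n = h N ∧ R n = R N) ∧
      (∀ R' ∈ transitionCouplings P Q, R N *ᵥ g N ≤ R' *ᵥ g N) ∧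
      ∀ R' ∈ transitionCouplings P Q, R N *ᵥ h N ≤ R' *ᵥ h N := by
  obtain ⟨N, hN⟩ := H.exists_succ_eq hP hQ hp hq hpP hqQ
  have hmin := ExactTCI.minimal_of_eq (hN ▸ H.improvement N)
  refine ⟨N, fun n hn => ?_, hmin⟩
  induction n, hn using Nat.le_induction with
  | base => exact ⟨rfl, rfl, rfl⟩
  | succ n _ ih =>
    obtain ⟨h1, h2, h3⟩ := ih
    have hR : R (n + 1) = R N := by
      have hI := H.improvement n
      rw [h1, h2, h3] at hI
      exact hI.eq_of_minimal (H.mem hP hQ N) hmin.1 hmin.2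
    have hE := H.evaluation (n + 1)
    rw [hR] at hE
    obtain ⟨h4, h5⟩ := hE.unique
      (stochastic_of_mem_transitionCouplings hP (H.mem hP hQ _)) (H.evaluation N)
    exact ⟨h4, h5, hR⟩

end IsExactOTCRun

end Run

/-! ### Randomized policies and the optimality equations. -/

section Policies

variable {X Y : Type*} [Fintype X] [Fintype Y] {P : Matrix X X ℝ} {Q : Matrix Y Y ℝ}
  {γ : X × Y → Measure (X × Y → ℝ)}

/-- The transition matrix of the state process under a policy. -/
noncomputable def policyMatrix {S : Type*} (γ : S → Measure (S → ℝ)) : Matrix S S ℝ :=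
  of fun s s' => ∫ r, r s' ∂(γ s)

theorem IsPolicy.integrable_apply (hγ : IsPolicy P Q γ) (s s' : X × Y) :
    Integrable (fun r : X × Y → ℝ => r s') (γ s) := by
  have := hγ.isProbabilityMeasure s
  refine Integrable.of_bound (measurable_pi_apply s').aestronglyMeasurable (P s.1 s'.1) ?_
  filter_upwards [hγ.admissible s] with r hr
  rw [Real.norm_eq_abs, abs_of_nonneg (hr.1 s')]
  exact le_of_mem_couplings hr s'

theorem IsPolicy.policyMatrix_mem (hγ : IsPolicy P Q γ) :
    policyMatrix γ ∈ transitionCouplings P Q := by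
  intro s
  have := hγ.isProbabilityMeasure s
  refine ⟨fun s' => ?_, fun x => ?_, fun y => ?_⟩
  · exact integral_nonneg_of_ae ((hγ.admissible s).mono fun r hr => hr.1 s')
  · simp only [policyMatrix, of_apply]
    rw [← integral_finsetSum _ fun y _ => hγ.integrable_apply s (x, y),
      integral_congr_ae ((hγ.admissible s).mono fun r hr => hr.2.1 x)]
    simp
  · simp only [policyMatrix, of_apply]
    rw [← integral_finsetSum _ fun x _ => hγ.integrable_apply s (x, y),
      integral_congr_ae ((hγ.admissible s).mono fun r hr => hr.2.2 y)]
    simp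

theorem isPolicy_detPolicy {R : Matrix (X × Y) (X × Y) ℝ} (hR : R ∈ transitionCouplings P Q) :
    IsPolicy P Q (detPolicy R) :=
  ⟨fun _ => Measure.dirac.isProbabilityMeasure, fun s => by
    rw [detPolicy, ae_dirac_eq]
    exact hR s⟩

variable [DecidableEq X] [DecidableEq Y]

/-- The expected future cost is linear in the action, so randomization enters only through the mean
action, which is again a coupling. -/
theorem IsPolicy.expectedCost_eq (hγ : IsPolicy P Q γ) (c : X × Y → ℝ) (t : ℕ) :
    expectedCost γ c t = (policyMatrix γ ^ t) *ᵥ c := by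
  induction t with
  | zero =>
    funext s
    simp [expectedCost]
  | succ t ih =>
    funext s
    rw [pow_succ', ← mulVec_mulVec, ← ih, expectedCost,
      integral_finsetSum _ fun s' _ => (hγ.integrable_apply s s').mul_const _]
    exact Finset.sum_congr rfl fun s' _ => integral_mul_const _ _

theorem IsPolicy.hasAverageCost (hγ : IsPolicy P Q γ) {M : Matrix (X × Y) (X × Y) ℝ}
    (hM : IsErgodicLimit (policyMatrix γ) M) (c : X × Y → ℝ) (s : X × Y) :
    HasAverageCost γ c s ((M *ᵥ c) s) := by
  unfold HasAverageCost
  simp_rw [hγ.expectedCost_eq]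
  exact hM.tendsto_Icc c s

theorem policyMatrix_detPolicy {S : Type*} [Fintype S] (R : Matrix S S ℝ) :
    policyMatrix (detPolicy R) = R := by
  ext s s'
  simp [policyMatrix, detPolicy, integral_dirac]

/-- Gain comparison from the optimality equations. -/
theorem IsErgodicLimit.gain_le {S : Type*} [Fintype S] [DecidableEq S] {R R' M' : Matrix S S ℝ}
    (hM' : IsErgodicLimit R' M') {c g h : S → ℝ} (hg : g ≤ R' *ᵥ g)
    (heq : g + h = c + R *ᵥ h) (hh : R *ᵥ h ≤ R' *ᵥ h) : g ≤ M' *ᵥ c := by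
  have h1 : g + h ≤ c + R' *ᵥ h := heq.trans_le (add_le_add le_rfl hh)
  -- Averaging by `M'` turns `R' h` into `M' h`, so the bias cancels.
  have h2 := mulVec_mono_of_nonneg hM'.limit_nonneg h1
  rw [mulVec_add, mulVec_add, hM'.mulVec_mulVec_right] at h2
  exact (hM'.le_mulVec hg).trans (le_of_add_le_add_right h2)

theorem isSolution_of_minimal (hP : P ∈ rowStochastic ℝ X) {c g h : X × Y → ℝ}
    {R : Matrix (X × Y) (X × Y) ℝ} (hR : R ∈ transitionCouplings P Q) (hE : ExactTCE c R g h)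
    (hg : ∀ R' ∈ transitionCouplings P Q, R *ᵥ g ≤ R' *ᵥ g)
    (hh : ∀ R' ∈ transitionCouplings P Q, R *ᵥ h ≤ R' *ᵥ h) : IsSolution P Q c g h R where
  mem := hR
  gain s := by
    obtain ⟨M, hM⟩ := exists_isErgodicLimit (stochastic_of_mem_transitionCouplings hP hR)
    rw [hE.gain_eq hM]
    exact (isPolicy_detPolicy hR).hasAverageCost (by rwa [policyMatrix_detPolicy]) c s
  bias := hE.isBias (stochastic_of_mem_transitionCouplings hP hR)
  optimal γ hγ s := by
    obtain ⟨M, hM⟩ := exists_isErgodicLimit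
      (stochastic_of_mem_transitionCouplings hP hγ.policyMatrix_mem)
    exact ⟨_, hγ.hasAverageCost hM c s, hM.gain_le
      (hE.gain_fixed.symm.trans_le (hg _ hγ.policyMatrix_mem)) hE.cost_eq
      (hh _ hγ.policyMatrix_mem) s⟩
  gain_eq := hE.gain_fixed
  gain_min := hg
  bias_eq := hE.cost_eq
  bias_min := hh

end Policies

/-! ### Construction of Markov chains, the Markov property, lumping. -/

section MarkovLaw

theorem row_mem_stdSimplex {S : Type*} [Fintype S] [DecidableEq S] {R : Matrix S S ℝ}
    (hR : R ∈ rowStochastic ℝ S) (s : S) : R s ∈ stdSimplex ℝ S :=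
  ⟨hR.1 s, sum_row_of_mem_rowStochastic hR s⟩

theorem measurableSet_path_eq {S : Type*} [MeasurableSpace S] [MeasurableSingletonClass S]
    (I : Finset ℕ) (a : ℕ → S) : MeasurableSet {ω : ℕ → S | ∀ k ∈ I, ω k = a k} := by
  have h : {ω : ℕ → S | ∀ k ∈ I, ω k = a k} = ⋂ k ∈ I, (fun ω : ℕ → S => ω k) ⁻¹' {a k} := by
    ext ω
    simp
  rw [h]
  exact Finset.measurableSet_biInter _ fun k _ =>
    measurable_pi_apply k (measurableSet_singleton (a k))

variable {S : Type*} [Fintype S] [MeasurableSpace S] [MeasurableSingletonClass S]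

/-- The distribution with the given point masses. -/
noncomputable def simplexPMF (r : S → ℝ) (hr : r ∈ stdSimplex ℝ S) : PMF S :=
  PMF.ofFintype (fun s => ENNReal.ofReal (r s)) (by
    rw [← ENNReal.ofReal_sum_of_nonneg fun s _ => hr.1 s, hr.2, ENNReal.ofReal_one])

/-- The path of the iterated maps `u 0`, `u 1`, … from an initial state. -/
def iteratePath (ω : S × (ℕ → S → S)) : ℕ → S
  | 0 => ω.1
  | n + 1 => ω.2 n (iteratePath ω n)

theorem measurable_iteratePath : Measurable (iteratePath (S := S)) := by
  refine measurable_pi_iff.2 fun n => ?_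
  induction n with
  | zero => exact measurable_fst
  | succ n ih =>
    have h1 : Measurable fun z : (S → S) × S => z.1 z.2 := Measurable.of_discrete
    have h2 : Measurable fun ω : S × (ℕ → S → S) => ω.2 n := by fun_prop
    exact h1.comp (h2.prodMk ih)

theorem measure_eq_sum_inter_eq (m : Measure (ℕ → S)) (A : Set (ℕ → S)) (i : ℕ) :
    m A = ∑ s, m (A ∩ {ω | ω i = s}) := by
  have hms : ∀ s : S, MeasurableSet ((fun ω : ℕ → S => ω i) ⁻¹' {s}) := fun s =>
    measurable_pi_apply i (measurableSet_singleton s)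
  have h := sum_measure_preimage_singleton (μ := m.restrict A) (f := fun ω : ℕ → S => ω i)
    Finset.univ fun s _ => hms s
  rw [Finset.coe_univ, Set.preimage_univ, Measure.restrict_apply_univ] at h
  rw [← h]
  refine Finset.sum_congr rfl fun s _ => ?_
  rw [Measure.restrict_apply (hms s), Set.inter_comm]
  rfl

variable [DecidableEq S] {R : Matrix S S ℝ} {r : S → ℝ}

/-- Existence of the Markov chain with given initial distribution and transition matrix. -/
theorem exists_markovLaw (hR : R ∈ rowStochastic ℝ S) (hr : r ∈ stdSimplex ℝ S) :
    ∃ m : Measure (ℕ → S), IsProbabilityMeasure m ∧ ∀ (j : ℕ) (a : ℕ → S),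
      m {ω | ∀ k ∈ Finset.Icc 0 j, ω k = a k} =
        ENNReal.ofReal (r (a 0) * ∏ k ∈ Finset.Ico 0 j, R (a k) (a (k + 1))) := by
  let row : S → Measure S := fun s => (simplexPMF (R s) (row_mem_stdSimplex hR s)).toMeasure
  -- An initial state and an independent i.i.d. sequence of random maps, whose value at `s` has law
  -- `R s`.
  let κ : Measure (S × (ℕ → S → S)) :=
    (simplexPMF r hr).toMeasure.prod (Measure.infinitePi fun _ => Measure.pi row)
  refine ⟨κ.map iteratePath, Measure.isProbabilityMeasure_map
    measurable_iteratePath.aemeasurable, fun j a => ?_⟩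
  rw [Measure.map_apply measurable_iteratePath (measurableSet_path_eq _ a)]
  -- Following `a` constrains the `k`-th map only at the point `a k`, so the event is a product.
  have hset : iteratePath ⁻¹' {ω : ℕ → S | ∀ k ∈ Finset.Icc 0 j, ω k = a k} =
      {a 0} ×ˢ Set.pi (Finset.Ico 0 j : Finset ℕ) fun k => {u : S → S | u (a k) = a (k + 1)} := by
    ext ω
    simp only [Set.mem_preimage, Set.mem_ofPred_eq, Set.mem_prod, Set.mem_singleton_iff, Set.mem_pi,
      Finset.mem_coe, Finset.mem_Icc, Finset.mem_Ico, zero_le, true_and]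
    constructor
    · refine fun h => ⟨h 0 (Nat.zero_le _), fun k hk => ?_⟩
      rw [← h k hk.le, ← h (k + 1) hk]
      rfl
    · rintro ⟨h0, h⟩ k
      induction k with
      | zero => exact fun _ => h0
      | succ k ih =>
        intro hk
        rw [← h k hk, ← ih (Nat.le_of_succ_le hk)]
        rfl
  have hrow : ∀ s s' : S, Measure.pi row {u : S → S | u s = s'} = ENNReal.ofReal (R s s') := by
    intro s s'
    have := (measurePreserving_eval row s).measure_preimage
      (measurableSet_singleton s').nullMeasurableSet
    refine this.trans ?_
    rw [PMF.toMeasure_apply_singleton _ _ (measurableSet_singleton _)]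
    rfl
  rw [hset, Measure.prod_prod, Measure.infinitePi_pi _ fun _ _ => MeasurableSet.of_discrete,
    PMF.toMeasure_apply_singleton _ _ (measurableSet_singleton _),
    ENNReal.ofReal_mul (hr.1 _), ENNReal.ofReal_prod_of_nonneg fun _ _ => hR.1 _ _]
  simp_rw [hrow]
  rfl

variable {m : Measure (ℕ → S)}

/-- Splitting over the state at time `i` and overwriting `a i` by it reduces to paths prescribed
from time `i` on. The past is allowed to be an arbitrary product event `B`, since lumping knows it
only up to fibres. -/
theorem markov_step_aux (hR : R ∈ rowStochastic ℝ S) {B : ℕ → Set S} {i : ℕ}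
    (ih : ∀ j, i ≤ j → ∀ a : ℕ → S,
      m {ω | (∀ k < i, ω k ∈ B k) ∧ ∀ k ∈ Finset.Icc i j, ω k = a k} =
        m {ω | (∀ k < i, ω k ∈ B k) ∧ ω i = a i} *
          ENNReal.ofReal (∏ k ∈ Finset.Ico i j, R (a k) (a (k + 1))))
    (j : ℕ) (hj : i + 1 ≤ j) (a : ℕ → S) :
    m {ω | (∀ k < i + 1, ω k ∈ B k) ∧ ∀ k ∈ Finset.Icc (i + 1) j, ω k = a k} =
      (∑ s, (B i).indicator (fun s => m {ω | (∀ k < i, ω k ∈ B k) ∧ ω i = s}) s *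
          ENNReal.ofReal (R s (a (i + 1)))) *
        ENNReal.ofReal (∏ k ∈ Finset.Ico (i + 1) j, R (a k) (a (k + 1))) := by
  rw [measure_eq_sum_inter_eq m _ i, Finset.sum_mul]
  refine Finset.sum_congr rfl fun s _ => ?_
  by_cases hs : s ∈ B i
  · have hset : {ω : ℕ → S | (∀ k < i + 1, ω k ∈ B k) ∧ ∀ k ∈ Finset.Icc (i + 1) j, ω k = a k} ∩
        {ω | ω i = s} =
        {ω | (∀ k < i, ω k ∈ B k) ∧ ∀ k ∈ Finset.Icc i j, ω k = Function.update a i s k} := by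
      ext ω
      simp only [Set.mem_inter_iff, Set.mem_ofPred_eq, Finset.mem_Icc]
      constructor
      · rintro ⟨⟨h1, h2⟩, h3⟩
        refine ⟨fun k hk => h1 k (by lia), fun k hk => ?_⟩
        rcases eq_or_ne k i with rfl | hki
        · simpa using h3
        · rw [Function.update_of_ne hki]
          exact h2 k ⟨by lia, hk.2⟩
      · rintro ⟨h1, h2⟩
        have h3 : ω i = s := by simpa using h2 i ⟨le_rfl, by lia⟩
        refine ⟨⟨fun k hk => ?_, fun k hk => ?_⟩, h3⟩
        · rcases eq_or_ne k i with rfl | hki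
          · exact h3 ▸ hs
          · exact h1 k (by lia)
        · have := h2 k ⟨by lia, hk.2⟩
          rwa [Function.update_of_ne (by lia)] at this
    rw [hset, ih j (by lia), Set.indicator_of_mem hs, Function.update_self,
      ← Finset.prod_Ioo_mul_eq_prod_Ico (by lia : i < j), mul_assoc,
      ← ENNReal.ofReal_mul (hR.1 _ _), Function.update_self, Function.update_of_ne (by lia),
      mul_comm (R _ _), show Finset.Ioo i j = Finset.Ico (i + 1) j from rfl]
    congr 3
    refine Finset.prod_congr rfl fun k hk => ?_
    have := (Finset.mem_Ico.1 hk).1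
    rw [Function.update_of_ne (by lia), Function.update_of_ne (by lia)]
  · rw [Set.indicator_of_notMem hs, zero_mul, zero_mul]
    refine measure_mono_null (fun ω hω => ?_) measure_empty
    obtain ⟨⟨h1, -⟩, h3 : ω i = s⟩ := hω
    exact hs (h3 ▸ h1 i (Nat.lt_succ_self i))

/-- The Markov property. -/
theorem markov_property (hR : R ∈ rowStochastic ℝ S) (hr : r ∈ stdSimplex ℝ S)
    (hm : ∀ (j : ℕ) (a : ℕ → S), m {ω | ∀ k ∈ Finset.Icc 0 j, ω k = a k} =
      ENNReal.ofReal (r (a 0) * ∏ k ∈ Finset.Ico 0 j, R (a k) (a (k + 1))))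
    (B : ℕ → Set S) (i : ℕ) : ∀ j, i ≤ j → ∀ a : ℕ → S,
      m {ω | (∀ k < i, ω k ∈ B k) ∧ ∀ k ∈ Finset.Icc i j, ω k = a k} =
        m {ω | (∀ k < i, ω k ∈ B k) ∧ ω i = a i} *
          ENNReal.ofReal (∏ k ∈ Finset.Ico i j, R (a k) (a (k + 1))) := by
  induction i with
  | zero =>
    intro j _ a
    have h0 := hm 0 a
    simp only [Nat.not_lt_zero, IsEmpty.forall_iff, implies_true, true_and]
    simp only [Finset.Icc_self, Finset.mem_singleton, forall_eq, Finset.Ico_self,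
      Finset.prod_empty, mul_one] at h0
    rw [hm, h0, ENNReal.ofReal_mul (hr.1 _)]
  | succ i ih =>
    intro j hj a
    have h1 := markov_step_aux hR ih (i + 1) le_rfl a
    simp only [Finset.Icc_self, Finset.mem_singleton, forall_eq, Finset.Ico_self,
      Finset.prod_empty, ENNReal.ofReal_one, mul_one] at h1
    rw [h1, markov_step_aux hR ih j hj a]

theorem markov_step (hR : R ∈ rowStochastic ℝ S) (hr : r ∈ stdSimplex ℝ S)
    (hm : ∀ (j : ℕ) (a : ℕ → S), m {ω | ∀ k ∈ Finset.Icc 0 j, ω k = a k} =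
      ENNReal.ofReal (r (a 0) * ∏ k ∈ Finset.Ico 0 j, R (a k) (a (k + 1))))
    (B : ℕ → Set S) (i : ℕ) (s' : S) :
    m {ω | (∀ k < i + 1, ω k ∈ B k) ∧ ω (i + 1) = s'} =
      ∑ s, (B i).indicator (fun s => m {ω | (∀ k < i, ω k ∈ B k) ∧ ω i = s}) s *
        ENNReal.ofReal (R s s') := by
  have h1 := markov_step_aux hR (markov_property hR hr hm B i) (i + 1) le_rfl fun _ => s'
  simpa using h1

theorem measure_eval_eq_of_stationary (hR : R ∈ rowStochastic ℝ S) (hr : r ∈ stdSimplex ℝ S)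
    (hst : r ᵥ* R = r)
    (hm : ∀ (j : ℕ) (a : ℕ → S), m {ω | ∀ k ∈ Finset.Icc 0 j, ω k = a k} =
      ENNReal.ofReal (r (a 0) * ∏ k ∈ Finset.Ico 0 j, R (a k) (a (k + 1))))
    (i : ℕ) (s : S) : m {ω | ω i = s} = ENNReal.ofReal (r s) := by
  induction i generalizing s with
  | zero => simpa using hm 0 fun _ => s
  | succ i ih =>
    have h1 := markov_step hR hr hm (fun _ => Set.univ) i s
    simp only [Set.mem_univ, implies_true, true_and, Set.indicator_univ, ih] at h1
    rw [h1]
    simp_rw [← ENNReal.ofReal_mul (hr.1 _)]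
    rw [← ENNReal.ofReal_sum_of_nonneg fun s' _ => mul_nonneg (hr.1 _) (hR.1 _ _)]
    exact congrArg _ (congrFun hst s)

theorem isStationaryMarkovLaw_of_cylinder [IsProbabilityMeasure m] (hR : R ∈ rowStochastic ℝ S)
    (hr : r ∈ stdSimplex ℝ S) (hst : r ᵥ* R = r)
    (hm : ∀ (j : ℕ) (a : ℕ → S), m {ω | ∀ k ∈ Finset.Icc 0 j, ω k = a k} =
      ENNReal.ofReal (r (a 0) * ∏ k ∈ Finset.Ico 0 j, R (a k) (a (k + 1)))) :
    IsStationaryMarkovLaw m r R where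
  isProbabilityMeasure := inferInstance
  stochastic := hR
  distribution := hr
  stationary := hst
  cylinder i j hij a := by
    have h1 := markov_property hR hr hm (fun _ => Set.univ) i j hij a
    simp only [Set.mem_univ, implies_true, true_and] at h1
    rw [h1, measure_eval_eq_of_stationary hR hr hst hm, ENNReal.ofReal_mul (hr.1 _)]

/-- A function of a Markov chain along which the transition matrix lumps is a Markov chain. -/
theorem lumped_cylinder {X : Type*} [DecidableEq X] {P : Matrix X X ℝ} {p : X → ℝ} {f : S → X}
    (hR : R ∈ rowStochastic ℝ S) (hr : r ∈ stdSimplex ℝ S)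
    (hm : ∀ (j : ℕ) (a : ℕ → S), m {ω | ∀ k ∈ Finset.Icc 0 j, ω k = a k} =
      ENNReal.ofReal (r (a 0) * ∏ k ∈ Finset.Ico 0 j, R (a k) (a (k + 1))))
    (hPn : ∀ x x', 0 ≤ P x x') (hP : ∀ s x, (∑ s', if f s' = x then R s s' else 0) = P (f s) x)
    (hp : ∀ x, (∑ s, if f s = x then r s else 0) = p x) (j : ℕ) (a : ℕ → X) :
    m {ω | ∀ k ∈ Finset.Icc 0 j, f (ω k) = a k} =
      ENNReal.ofReal (p (a 0) * ∏ k ∈ Finset.Ico 0 j, P (a k) (a (k + 1))) := by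
  let B : ℕ → Set S := fun k => {s | f s = a k}
  have hdec : ∀ i, m {ω | ∀ k ∈ Finset.Icc 0 i, f (ω k) = a k} =
      ∑ s, (B i).indicator (fun s => m {ω | (∀ k < i, ω k ∈ B k) ∧ ω i = s}) s := by
    intro i
    rw [measure_eq_sum_inter_eq m _ i]
    refine Finset.sum_congr rfl fun s _ => ?_
    by_cases hs : s ∈ B i
    · rw [Set.indicator_of_mem hs]
      congr 1
      ext ω
      simp only [Set.mem_inter_iff, Set.mem_ofPred_eq, Finset.mem_Icc, zero_le, true_and, B]
      constructor
      · exact fun h => ⟨fun k hk => h.1 k hk.le, h.2⟩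
      · rintro ⟨h1, h2⟩
        refine ⟨fun k hk => ?_, h2⟩
        rcases hk.eq_or_lt with rfl | hk
        · exact h2 ▸ hs
        · exact h1 k hk
    · rw [Set.indicator_of_notMem hs]
      refine measure_mono_null (fun ω hω => ?_) measure_empty
      obtain ⟨h1, h3 : ω i = s⟩ := hω
      exact hs (h3 ▸ h1 i (by simp))
  induction j with
  | zero =>
    rw [hdec]
    have h0 : ∀ s, m {ω | ω 0 = s} = ENNReal.ofReal (r s) := fun s => by
      simpa using hm 0 fun _ => s
    simp only [Nat.not_lt_zero, IsEmpty.forall_iff, implies_true, true_and, h0, Finset.Ico_self,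
      Finset.prod_empty, mul_one]
    rw [← hp, ENNReal.ofReal_sum_of_nonneg fun s _ => by split_ifs <;> simp [hr.1 s]]
    refine Finset.sum_congr rfl fun s _ => ?_
    by_cases hs : f s = a 0
    · rw [Set.indicator_of_mem (show s ∈ B 0 from hs), if_pos hs]
    · rw [Set.indicator_of_notMem (show s ∉ B 0 from hs), if_neg hs, ENNReal.ofReal_zero]
  | succ j ih =>
    have hstep : m {ω | ∀ k ∈ Finset.Icc 0 (j + 1), f (ω k) = a k} =
        m {ω | ∀ k ∈ Finset.Icc 0 j, f (ω k) = a k} *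
          ENNReal.ofReal (P (a j) (a (j + 1))) := by
      rw [hdec (j + 1), hdec j, Finset.sum_mul]
      -- The mass that `R s` gives to a fibre depends on `s` only through `f s`, which is `a j` on
      -- `B j`, so it factors out.
      calc _ = ∑ s', ∑ s, (B j).indicator (fun s => m {ω | (∀ k < j, ω k ∈ B k) ∧ ω j = s}) s *
            ENNReal.ofReal (if f s' = a (j + 1) then R s s' else 0) := by
            refine Finset.sum_congr rfl fun s' _ => ?_
            by_cases hs : f s' = a (j + 1)
            · rw [Set.indicator_of_mem (show s' ∈ B (j + 1) from hs), markov_step hR hr hm]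
              simp only [if_pos hs]
            · rw [Set.indicator_of_notMem (show s' ∉ B (j + 1) from hs)]
              simp [if_neg hs]
        _ = _ := by
            rw [Finset.sum_comm]
            refine Finset.sum_congr rfl fun s _ => ?_
            rw [← Finset.mul_sum, ← ENNReal.ofReal_sum_of_nonneg
              fun s' _ => by split_ifs <;> simp [hR.1 s s'], hP]
            by_cases hs : f s = a j
            · rw [hs]
            · rw [Set.indicator_of_notMem (show s ∉ B j from hs), zero_mul, zero_mul]
    rw [hstep, ih, Finset.prod_Ico_succ_top (Nat.zero_le j), ← mul_assoc]
    exact (ENNReal.ofReal_mul' (hPn _ _)).symm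

end MarkovLaw

/-! ### Uniqueness of path laws and of stationary distributions. -/

section Uniqueness

/-- Laws of paths with values in a countable space are determined by the initial segments. -/
theorem measure_ext_of_path_eq {S : Type*} [Countable S] [MeasurableSpace S]
    [MeasurableSingletonClass S] {m m' : Measure (ℕ → S)} [IsFiniteMeasure m]
    (h : ∀ (j : ℕ) (a : ℕ → S), m {ω | ∀ k ∈ Finset.Icc 0 j, ω k = a k} =
      m' {ω | ∀ k ∈ Finset.Icc 0 j, ω k = a k}) : m = m' := by
  have hIcc : ∀ j : ℕ, m.map (Finset.Icc 0 j).restrict = m'.map (Finset.Icc 0 j).restrict := by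
    intro j
    refine Measure.ext_of_singleton fun b => ?_
    -- The segment is prolonged by its last value; only times up to `j` are tested.
    let a : ℕ → S := fun k => b ⟨min k j, by simp⟩
    have hset : ((Finset.Icc 0 j).restrict : (ℕ → S) → _) ⁻¹' {b} =
        {ω : ℕ → S | ∀ k ∈ Finset.Icc 0 j, ω k = a k} := by
      ext ω
      simp only [Set.mem_preimage, Set.mem_singleton_iff, funext_iff, Subtype.forall,
        Finset.restrict, Set.mem_ofPred_eq]
      refine forall₂_congr fun k hk => ?_
      have : min k j = k := min_eq_left (Finset.mem_Icc.1 hk).2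
      simp only [a, this]
    rw [Measure.map_apply (Finset.measurable_restrict _) (measurableSet_singleton b),
      Measure.map_apply (Finset.measurable_restrict _) (measurableSet_singleton b), hset, h]
  refine IsProjectiveLimit.unique (P := fun I => m.map I.restrict) (fun I => rfl) fun I => ?_
  obtain ⟨j, hj⟩ : ∃ j, I ⊆ Finset.Icc 0 j :=
    ⟨I.sup id, fun k hk => Finset.mem_Icc.2 ⟨Nat.zero_le _, Finset.le_sup (f := id) hk⟩⟩
  have hcomp : (I.restrict : (ℕ → S) → I → S) =
      Finset.restrict₂ hj ∘ (Finset.Icc 0 j).restrict := rfl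
  change m'.map I.restrict = m.map I.restrict
  rw [hcomp, ← Measure.map_map (Finset.measurable_restrict₂ hj) (Finset.measurable_restrict _),
    ← hIcc, Measure.map_map (Finset.measurable_restrict₂ hj) (Finset.measurable_restrict _)]

/-- The stationary distribution of an irreducible chain is unique. -/
theorem stationary_unique {X : Type*} [Fintype X] [DecidableEq X] {P : Matrix X X ℝ}
    (hP : P.IsIrreducible) {p p' : X → ℝ} (hp : ∀ x, 0 < p x) (hp1 : ∑ x, p x = 1)
    (hpP : p ᵥ* P = p) (hp1' : ∑ x, p' x = 1) (hpP' : p' ᵥ* P = p') : p' = p := by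
  have : Nonempty X := by
    by_contra hX
    rw [not_nonempty_iff] at hX
    simp at hp1
  obtain ⟨x₀, hx₀⟩ := Finite.exists_min fun x => p' x / p x
  -- With the least ratio, `p' - t p` is a nonnegative invariant vector with a zero at `x₀`. Every
  -- state reaches `x₀`, so it vanishes everywhere.
  set t := p' x₀ / p x₀ with ht
  set v := p' - t • p with hv
  have hv0 : ∀ x, 0 ≤ v x := fun x => by
    have := (le_div_iff₀ (hp x)).1 (hx₀ x)
    simpa [hv] using this
  have hvx : v x₀ = 0 := by
    simp [hv, ht, div_mul_cancel₀ _ (hp x₀).ne']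
  have hvP : v ᵥ* P = v := by rw [hv, sub_vecMul, smul_vecMul, hpP, hpP']
  have hpow : ∀ k : ℕ, v ᵥ* P ^ k = v := by
    intro k
    induction k with
    | zero => simp
    | succ k ih => rw [pow_succ, ← vecMul_vecMul, ih, hvP]
  have hvz : ∀ x, v x = 0 := by
    intro x
    obtain ⟨k, -, hk⟩ := (isIrreducible_iff_exists_pow_pos hP.nonneg).1 hP x x₀
    have h1 : ∑ y, v y * (P ^ k) y x₀ = 0 := (congrFun (hpow k) x₀).trans hvx
    rw [Finset.sum_eq_zero_iff_of_nonneg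
      fun y _ => mul_nonneg (hv0 y) (pow_apply_nonneg hP.nonneg k y x₀)] at h1
    exact (mul_eq_zero.1 (h1 x (Finset.mem_univ x))).resolve_right hk.ne'
  have hpp : ∀ x, p' x = t * p x := fun x => by
    have := hvz x
    simpa [hv, sub_eq_zero] using this
  have ht1 : t = 1 := by
    rw [← hp1', Finset.sum_congr rfl fun x _ => hpp x, ← Finset.mul_sum, hp1, mul_one]
  funext x
  rw [hpp, ht1, one_mul]

/-- The image of a stationary distribution under a lumping is stationary. -/
theorem lumped_stationary {S X : Type*} [Fintype S] [Fintype X] [DecidableEq X]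
    {R : Matrix S S ℝ} {P : Matrix X X ℝ} {r : S → ℝ} {f : S → X}
    (hP : ∀ s x, (∑ s', if f s' = x then R s s' else 0) = P (f s) x) (hst : r ᵥ* R = r) :
    (fun x => ∑ s, if f s = x then r s else 0) ᵥ* P = fun x => ∑ s, if f s = x then r s else 0 := by
  funext x'
  calc ∑ x, (∑ s, if f s = x then r s else 0) * P x x'
      = ∑ s, r s * P (f s) x' := by
        simp_rw [Finset.sum_mul]
        rw [Finset.sum_comm]
        refine Finset.sum_congr rfl fun s _ => ?_
        simp [ite_mul]
    _ = ∑ s', ∑ s, if f s' = x' then r s * R s s' else 0 := by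
        rw [Finset.sum_comm]
        refine Finset.sum_congr rfl fun s _ => ?_
        rw [← hP, Finset.mul_sum]
        simp
    _ = ∑ s', if f s' = x' then r s' else 0 := by
        refine Finset.sum_congr rfl fun s' _ => ?_
        split_ifs
        · exact congrFun hst s'
        · simp

variable {S X : Type*} [Fintype S] [DecidableEq S] [MeasurableSpace S] [MeasurableSingletonClass S]
  [Fintype X] [DecidableEq X] [MeasurableSpace X] [MeasurableSingletonClass X]

/-- A lumping of a stationary chain onto an irreducible transition matrix has the law of the
stationary chain of that matrix. -/
theorem IsStationaryMarkovLaw.map_eq_of_lumping {m : Measure (ℕ → S)} {r : S → ℝ}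
    {R : Matrix S S ℝ} (hm : IsStationaryMarkovLaw m r R) {μ : Measure (ℕ → X)} {p : X → ℝ}
    {P : Matrix X X ℝ} (hμ : IsStationaryMarkovLaw μ p P) (hp : ∀ x, 0 < p x)
    (hP : P.IsIrreducible) {f : S → X}
    (hf : ∀ s x, (∑ s', if f s' = x then R s s' else 0) = P (f s) x) :
    m.map (fun ω i => f (ω i)) = μ := by
  have hpr : (fun x => ∑ s, if f s = x then r s else 0) = p := by
    refine stationary_unique hP hp hμ.distribution.2 hμ.stationary ?_
      (lumped_stationary hf hm.stationary)
    rw [Finset.sum_comm]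
    simpa using hm.distribution.2
  have hmeas : Measurable fun (ω : ℕ → S) (i : ℕ) => f (ω i) :=
    measurable_pi_iff.2 fun i => (Measurable.of_discrete (f := f)).comp (measurable_pi_apply i)
  have := hm.isProbabilityMeasure
  have := Measure.isProbabilityMeasure_map (μ := m) hmeas.aemeasurable
  refine measure_ext_of_path_eq fun j a => ?_
  rw [Measure.map_apply hmeas (measurableSet_path_eq _ a), hμ.cylinder 0 j (Nat.zero_le j)]
  exact lumped_cylinder hm.stochastic hm.distribution
    (fun j a => hm.cylinder 0 j (Nat.zero_le j) a) hμ.stochastic.1 hf (congrFun hpr) j a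

theorem exists_isStationaryMarkovLaw {R : Matrix S S ℝ} {r : S → ℝ}
    (hR : R ∈ rowStochastic ℝ S) (hr : r ∈ stdSimplex ℝ S) (hst : r ᵥ* R = r) :
    ∃ m, IsStationaryMarkovLaw m r R := by
  obtain ⟨m, hm, hcyl⟩ := exists_markovLaw hR hr
  exact ⟨m, isStationaryMarkovLaw_of_cylinder hR hr hst hcyl⟩

end Uniqueness

/-! ### Optimal transition couplings for irreducible marginals. -/

section Optimality

theorem measurable_zip {X Y : Type*} [MeasurableSpace X] [MeasurableSpace Y] :
    Measurable fun (ω : (ℕ → X) × (ℕ → Y)) (i : ℕ) => (ω.1 i, ω.2 i) := by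
  fun_prop

theorem sum_ite_fst_of_mem_transitionCouplings {X Y : Type*} [Fintype X] [DecidableEq X]
    [Fintype Y] {P : Matrix X X ℝ} {Q : Matrix Y Y ℝ} {R : Matrix (X × Y) (X × Y) ℝ}
    (hR : R ∈ transitionCouplings P Q) (s : X × Y) (x : X) :
    (∑ s' : X × Y, if s'.1 = x then R s s' else 0) = P s.1 x := by
  rw [Fintype.sum_prod_type, Finset.sum_eq_single x]
  · simpa using (hR s).2.1 x
  · intro x' _ hx
    simp [hx]
  · simp

theorem sum_ite_snd_of_mem_transitionCouplings {X Y : Type*} [Fintype X] [Fintype Y]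
    [DecidableEq Y] {P : Matrix X X ℝ} {Q : Matrix Y Y ℝ} {R : Matrix (X × Y) (X × Y) ℝ}
    (hR : R ∈ transitionCouplings P Q) (s : X × Y) (y : Y) :
    (∑ s' : X × Y, if s'.2 = y then R s s' else 0) = Q s.2 y := by
  rw [Fintype.sum_prod_type_right, Finset.sum_eq_single y]
  · simpa using (hR s).2.2 y
  · intro y' _ hy
    simp [hy]
  · simp

variable {X Y : Type*} [Fintype X] [DecidableEq X] [MeasurableSpace X]
  [Fintype Y] [DecidableEq Y] [MeasurableSpace Y] {P : Matrix X X ℝ} {Q : Matrix Y Y ℝ}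

theorem integral_cost_eq [MeasurableSingletonClass X] [MeasurableSingletonClass Y]
    {π : Measure ((ℕ → X) × (ℕ → Y))} {r : X × Y → ℝ} {R : Matrix (X × Y) (X × Y) ℝ}
    (hπ : IsStationaryMarkovLaw
      (π.map fun ω : (ℕ → X) × (ℕ → Y) => fun i => (ω.1 i, ω.2 i)) r R) (c : X × Y → ℝ) :
    ∫ ω, c (ω.1 0, ω.2 0) ∂π = r ⬝ᵥ c := by
  set m := π.map fun ω : (ℕ → X) × (ℕ → Y) => fun i => (ω.1 i, ω.2 i) with hm
  have := hπ.isProbabilityMeasure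
  have heval : Measurable fun ω : ℕ → X × Y => ω 0 := measurable_pi_apply 0
  have := Measure.isProbabilityMeasure_map (μ := m) heval.aemeasurable
  calc ∫ ω, c (ω.1 0, ω.2 0) ∂π = ∫ ω, c (ω 0) ∂m := by
        exact (integral_map measurable_zip.aemeasurable
          ((Measurable.of_discrete (f := c)).comp heval).aestronglyMeasurable).symm
    _ = ∫ s, c s ∂(m.map fun ω => ω 0) := by
        rw [integral_map heval.aemeasurable Measurable.of_discrete.aestronglyMeasurable]
    _ = r ⬝ᵥ c := by
        rw [integral_fintype Integrable.of_finite]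
        refine Finset.sum_congr rfl fun s _ => ?_
        have hs := hπ.cylinder 0 0 le_rfl fun _ => s
        simp only [Finset.Icc_self, Finset.mem_singleton, forall_eq, Finset.Ico_self,
          Finset.prod_empty, mul_one] at hs
        rw [measureReal_def, Measure.map_apply heval (measurableSet_singleton s)]
        change (m {ω | ω 0 = s}).toReal • c s = _
        rw [hs, ENNReal.toReal_ofReal (hπ.distribution.1 s), smul_eq_mul]

variable [MeasurableSingletonClass X] [MeasurableSingletonClass Y]

/-- For irreducible marginals, a stationary distribution of a transition coupling matrix gives a
transition coupling. -/
theorem exists_isTransitionCoupling {μ : Measure (ℕ → X)} {p : X → ℝ} {ν : Measure (ℕ → Y)}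
    {q : Y → ℝ} (hX : IsStationaryMarkovLaw μ p P) (hp : ∀ x, 0 < p x)
    (hY : IsStationaryMarkovLaw ν q Q) (hq : ∀ y, 0 < q y) (hP : P.IsIrreducible)
    (hQ : Q.IsIrreducible) {R : Matrix (X × Y) (X × Y) ℝ} (hR : R ∈ transitionCouplings P Q)
    {r : X × Y → ℝ} (hr : r ∈ stdSimplex ℝ (X × Y)) (hst : r ᵥ* R = r) :
    ∃ π, IsTransitionCoupling P Q μ ν R π ∧ IsStationaryMarkovLaw
      (π.map fun ω : (ℕ → X) × (ℕ → Y) => fun i => (ω.1 i, ω.2 i)) r R := by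
  obtain ⟨m, hm⟩ := exists_isStationaryMarkovLaw
    (stochastic_of_mem_transitionCouplings hX.stochastic hR) hr hst
  have hunzip : Measurable fun ω : ℕ → X × Y => ((fun i => (ω i).1, fun i => (ω i).2) :
      (ℕ → X) × (ℕ → Y)) := by fun_prop
  have hlaw : IsStationaryMarkovLaw ((m.map fun ω : ℕ → X × Y =>
      ((fun i => (ω i).1, fun i => (ω i).2) : (ℕ → X) × (ℕ → Y))).map
        fun ω : (ℕ → X) × (ℕ → Y) => fun i => (ω.1 i, ω.2 i)) r R := by
    rw [Measure.map_map measurable_zip hunzip]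
    exact (Measure.map_id (μ := m)).symm ▸ hm
  refine ⟨_, ⟨hR, ?_, ?_, r, hlaw⟩, hlaw⟩
  · rw [Measure.map_map measurable_fst hunzip]
    exact hm.map_eq_of_lumping hX hp hP (sum_ite_fst_of_mem_transitionCouplings hR)
  · rw [Measure.map_map measurable_snd hunzip]
    exact hm.map_eq_of_lumping hY hq hQ (sum_ite_snd_of_mem_transitionCouplings hR)

theorem isOptimalTransitionMatrix_of_minimal {μ : Measure (ℕ → X)} {p : X → ℝ}
    {ν : Measure (ℕ → Y)} {q : Y → ℝ} (hX : IsStationaryMarkovLaw μ p P) (hp : ∀ x, 0 < p x)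
    (hY : IsStationaryMarkovLaw ν q Q) (hq : ∀ y, 0 < q y) (hP : P.IsIrreducible)
    (hQ : Q.IsIrreducible) {c g h : X × Y → ℝ} {R : Matrix (X × Y) (X × Y) ℝ}
    (hR : R ∈ transitionCouplings P Q) (hE : ExactTCE c R g h)
    (hg : ∀ R' ∈ transitionCouplings P Q, R *ᵥ g ≤ R' *ᵥ g)
    (hh : ∀ R' ∈ transitionCouplings P Q, R *ᵥ h ≤ R' *ᵥ h) :
    IsOptimalTransitionMatrix P Q μ ν c R := by
  have hne : Nonempty (X × Y) := by
    by_contra hne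
    rw [not_nonempty_iff, isEmpty_prod] at hne
    rcases hne with hne | hne
    · simpa using hX.distribution.2
    · simpa using hY.distribution.2
  obtain ⟨M, hM⟩ := exists_isErgodicLimit (stochastic_of_mem_transitionCouplings hX.stochastic hR)
  obtain ⟨s₀, hs₀⟩ := Finite.exists_min g
  -- Row `s₀` of `M` is stationary for `R`, and its expected cost is the least gain `g s₀`.
  obtain ⟨π, hπ, hlaw⟩ := exists_isTransitionCoupling hX hp hY hq hP hQ hR
    (row_mem_stdSimplex hM.limit_mem s₀) (congrFun hM.limit_mul s₀)
  refine ⟨π, hπ, fun R' π' hπ' => ?_⟩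
  obtain ⟨r', hlaw'⟩ := hπ'.markov
  obtain ⟨M', hM'⟩ := exists_isErgodicLimit hlaw'.stochastic
  have hgain : g ≤ M' *ᵥ c := hM'.gain_le (hE.gain_fixed.symm.trans_le (hg _ hπ'.mem)) hE.cost_eq
    (hh _ hπ'.mem)
  -- Thus the cost of the competitor is the `r'`-average of its gain `M' c`, which dominates `g` and
  -- hence `g s₀`.
  have hr' : r' ᵥ* M' = r' := by
    obtain ⟨W, hW⟩ := hM'.exists_potential
    have h1 : r' ᵥ* (1 - R') = 0 := by
      rw [vecMul_sub, vecMul_one, hlaw'.stationary, sub_self]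
    calc r' ᵥ* M' = r' ᵥ* (M' + (1 - R') * W) := by
          rw [vecMul_add, ← vecMul_vecMul, h1, zero_vecMul, add_zero]
      _ = r' := by rw [← hW, vecMul_one]
  rw [integral_cost_eq hlaw, integral_cost_eq hlaw']
  calc M s₀ ⬝ᵥ c = g s₀ := (congrFun (hE.gain_eq hM) s₀).symm
    _ = ∑ s, r' s * g s₀ := by rw [← Finset.sum_mul, hlaw'.distribution.2, one_mul]
    _ ≤ ∑ s, r' s * (M' *ᵥ c) s := Finset.sum_le_sum fun s _ =>
        mul_le_mul_of_nonneg_left ((hs₀ s).trans (hgain s)) (hlaw'.distribution.1 s)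
    _ = r' ⬝ᵥ c := by
        change r' ⬝ᵥ (M' *ᵥ c) = _
        rw [dotProduct_mulVec, hr']

end Optimality

end OTC

theorem mainTheorem1 {X Y : Type*}
    [Fintype X] [DecidableEq X] [MeasurableSpace X] [MeasurableSingletonClass X]
    [Fintype Y] [DecidableEq Y] [MeasurableSpace Y] [MeasurableSingletonClass Y]
    (μ : Measure (ℕ → X)) (p : X → ℝ) (P : Matrix X X ℝ)
    (ν : Measure (ℕ → Y)) (q : Y → ℝ) (Q : Matrix Y Y ℝ)
    (hX : OTC.IsStationaryMarkovLaw μ p P) (hp : ∀ x, 0 < p x)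
    (hY : OTC.IsStationaryMarkovLaw ν q Q) (hq : ∀ y, 0 < q y)
    (c : X × Y → ℝ) :
    (∃ g h R, OTC.IsExactOTCRun P Q c g h R) ∧
    ∀ g h R, OTC.IsExactOTCRun P Q c g h R →
      ∃ (g' h' : X × Y → ℝ) (R' : Matrix (X × Y) (X × Y) ℝ),
        (∃ N : ℕ, ∀ n ≥ N, g n = g' ∧ h n = h' ∧ R n = R') ∧
        OTC.IsSolution P Q c g' h' R' ∧
        (P.IsIrreducible → Q.IsIrreducible →
          OTC.IsOptimalTransitionMatrix P Q μ ν c R') := by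
  have hP := hX.stochastic
  have hQ := hY.stochastic
  refine ⟨OTC.exists_isExactOTCRun hP hQ c, fun g h R H => ?_⟩
  obtain ⟨N, hN, hg, hh⟩ := H.exists_forall_eq hP hQ hp hq hX.stationary hY.stationary
  exact ⟨g N, h N, R N, ⟨N, hN⟩,
    OTC.isSolution_of_minimal hP (H.mem hP hQ N) (H.evaluation N) hg hh,
    fun hPi hQi => OTC.isOptimalTransitionMatrix_of_minimal hX hp hY hq hPi hQi (H.mem hP hQ N)
      (H.evaluation N) hg hh⟩
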